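/- Let $G$ be a finite-dimensional real Lie group with Lie algebra $\mathfrak g$, let $(U,\mathcal H)$ be a (strongly continuous) unitary representation of $G$ on a complex Hilbert space, let $h\in\mathfrak g$, and let $J\colon\mathcal H\to\mathcal H$ be a conjugation (an antilinear isometry with $J^2=1$) that commutes with $U(\exp th)$ for all $t\in\mathbb R$ and satisfies $J\mathcal H^\infty\subseteq\mathcal H^\infty$. Here $\mathcal H^\infty$ is the space of smooth vectors, i.e. of those $\xi\in\mathcal H$ whose orbit map $g\mapsto U(g)\xi$ is smooth, with the topology given by the seminorms $\xi\mapsto\|\mathrm dU(x_1)\cdots \mathrm dU(x_k)\xi\|$ ($k\ge 0$, $x_1,\dots,x_k\in\mathfrak g$), where $\mathrm dU$ is the derived representation. Let $\mathcal H^{-\infty}$ be the space of continuous antilinear functionals on $\mathcal H^\infty$ (distribution vectors) with the weak-$*$-topology, and write $\langle\xi,\eta\rangle:=\eta(\xi)$. For $t\in\mathbb R$, let $U^\infty_{h,t}$ be the restriction of $U(\exp th)$ to $\mathcal H^\infty$, let $J^\infty:=J|_{\mathcal H^\infty}$, and put $U^{-\infty}_{h,t}\eta:=\eta\circ U^\infty_{h,-t}$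 and $J^{-\infty}\eta:=\overline{\eta\circ J^\infty}$ for $\eta\in\mathcal H^{-\infty}$. For a one-parameter group $(V_t)_{t\in\mathbb R}$ on $\mathcal Y=\mathcal H^{\infty}$ or $\mathcal Y=\mathcal H^{-\infty}$, let $\mathcal D(V_{i\pi})$ be the set of all $y\in\mathcal Y$ for which there is a continuous map $F_y\colon\{z\in\mathbb C: 0\le\operatorname{Im}z\le\pi\}\to\mathcal Y$ such that $F_y(t)=V_ty$ for all $t\in\mathbb R$ and $\alpha\circ F_y$ is holomorphic on $\{0<\operatorname{Im}z<\pi\}$ for every continuous linear functional $\alpha$ on $\mathcal Y$; such an $F_y$ is unique, and $V_{i\pi}y:=F_y(i\pi)$. Define $$\mathcal H^{-\infty}_{\rm KMS}:=\{\eta\in\mathcal D(U^{-\infty}_{h,i\pi}) : U^{-\infty}_{h,i\pi}\eta=J^{-\infty}\eta\}.$$ Then $\mathcal H^{-\infty}_{\rm KMS}$ is a weak-$*$-closed real linear subspace of $\mathcal H^{-\infty}$, and $$\mathcal H^{-\infty}_{\rm KMS}=\{\eta\in\mathcal H^{-\infty} : \operatorname{Re}\langle U^\infty_{h,i\pi}\xi-J^\infty\xi,\,\eta\rangle=0\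 \text{ for all } \xi\in\mathcal D(U^\infty_{h,i\pi})\},$$ that is, $\mathcal H^{-\infty}_{\rm KMS}$ is the annihilator of $(U^\infty_{h,i\pi}-J^\infty)\mathcal D(U^\infty_{h,i\pi})$ with respect to the real duality pairing $\operatorname{Re}\langle\cdot,\cdot\rangle$. -/

import Mathlib

open scoped Manifold ContDiff

noncomputable section

namespace LieRep

/-! ### Analytic extension of orbit maps -/

section Strip

/-- The closed strip `0 ≤ Im z ≤ b`. -/
def closedStrip (b : ℝ) : Set ℂ := {z | 0 ≤ z.im ∧ z.im ≤ b}

/-- The open strip `0 < Im z < b`. -/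
def openStrip (b : ℝ) : Set ℂ := {z | 0 < z.im ∧ z.im < b}

variable {Y : Type*} [AddCommGroup Y] [Module ℂ Y] [TopologicalSpace Y]

/-- `F` is, on the strip `0 ≤ Im z ≤ b`, an extension of the orbit map `t ↦ V t y` which is
continuous on the closed strip and weakly holomorphic on the open strip.
Only the values of `F` on the closed strip matter. -/
structure IsOrbitExtension (V : ℝ → Y → Y) (b : ℝ) (y : Y) (F : ℂ → Y) : Prop where
  continuousOn : ContinuousOn F (closedStrip b)
  weaklyHolomorphic : ∀ α : Y →L[ℂ] ℂ, DifferentiableOn ℂ (fun z => α (F z)) (openStrip b)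
  extends_orbit : ∀ t : ℝ, F (t : ℂ) = V t y

/-- For `b > 0`, the domain `D(V_{ib})` of the operator `V_{ib}`: all vectors whose orbit map
extends to the strip `0 ≤ Im z ≤ b`. -/
def extDomain (V : ℝ → Y → Y) (b : ℝ) : Set Y :=
  {y | ∃ F : ℂ → Y, IsOrbitExtension V b y F}

open Classical in
/-- For `b > 0`, the operator `V_{ib}`, `V_{ib} y = F_y(ib)` for `y ∈ D(V_{ib})`, where `F_y` is
the (unique) extension of the orbit map of `y`. The value `0` outside the domain is irrelevant. -/
def extOp (V : ℝ → Y → Y) (b : ℝ) (y : Y) : Y :=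
  if hy : ∃ F : ℂ → Y, IsOrbitExtension V b y F then hy.choose (Complex.I * b) else 0

end Strip

/-! ### Exponential map and adjoint action of a Lie group -/

section Lie

variable {E : Type*} [NormedAddCommGroup E] [NormedSpace ℝ E]
  {G : Type*} [TopologicalSpace G] [ChartedSpace E G] [Group G]

open Classical in
/-- The exponential map: `exp x = γ 1`, where `γ` is the (unique, everywhere defined) integral
curve through `1` of the left invariant vector field with value `x` at `1`. -/
def lieExp (x : GroupLieAlgebra 𝓘(ℝ, E) G) : G :=
  if hx : ∃ γ : ℝ → G, γ 0 = 1 ∧ IsMIntegralCurve γ (mulInvariantVectorField x) then hx.choose 1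
  else 1

end Lie

/-! ### Smooth vectors and distribution vectors of a unitary representation -/

section Rep

variable {E : Type*} [NormedAddCommGroup E] [NormedSpace ℝ E]
  {G : Type*} [TopologicalSpace G] [ChartedSpace E G] [Group G]
  {H : Type*} [NormedAddCommGroup H] [InnerProductSpace ℂ H]

variable (E) in
/-- The space `H^∞` of smooth vectors, as a linear subspace of `H`. -/
def smoothVectors (U : G →* (H ≃ₗᵢ[ℂ] H)) : Submodule ℂ H where
  carrier := {ξ | ContMDiff 𝓘(ℝ, E) 𝓘(ℝ, H) ∞ (fun g => U g ξ)}
  zero_mem' := by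
    simp only [Set.mem_ofPred_eq, map_zero]
    exact contMDiff_const
  add_mem' := by
    intro a b ha hb
    simp only [Set.mem_ofPred_eq, map_add] at *
    exact ha.add hb
  smul_mem' := by
    intro c a ha
    simp only [Set.mem_ofPred_eq, map_smul] at *
    exact ((c • ContinuousLinearMap.id ℝ H).contMDiff).comp ha

variable (E) in
/-- The space `H^∞` with its Fréchet topology (a type synonym, since the topology is not the
subspace topology). -/
def SmoothVec (U : G →* (H ≃ₗᵢ[ℂ] H)) : Type _ := smoothVectors E U

variable {U : G →* (H ≃ₗᵢ[ℂ] H)}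

instance : AddCommGroup (SmoothVec E U) := inferInstanceAs (AddCommGroup (smoothVectors E U))
instance : Module ℂ (SmoothVec E U) := inferInstanceAs (Module ℂ (smoothVectors E U))

/-- The inclusion `H^∞ → H`. -/
def SmoothVec.val (ξ : SmoothVec E U) : H := Subtype.val (p := (· ∈ smoothVectors E U)) ξ

/-- The derived representation: `dU(x) ξ` is the derivative at `1` in the direction `x` of the
orbit map `g ↦ U g ξ`. -/
def derivedRep (U : G →* (H ≃ₗᵢ[ℂ] H)) (x : GroupLieAlgebra 𝓘(ℝ, E) G) (ξ : H) : H :=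
  mfderiv 𝓘(ℝ, E) 𝓘(ℝ, H) (fun g => U g ξ) 1 x

/-- `dU(x₁) ⋯ dU(x_k) ξ` for a word `L = (x₁, …, x_k)` in the Lie algebra. -/
def derivedWord (U : G →* (H ≃ₗᵢ[ℂ] H)) (L : List (GroupLieAlgebra 𝓘(ℝ, E) G)) (ξ : H) : H :=
  L.foldr (derivedRep U) ξ

/-- The topology of `H^∞`, defined by the seminorms `ξ ↦ ‖dU(x₁) ⋯ dU(x_k) ξ‖`, `k ≥ 0`,
`x₁, …, x_k ∈ 𝔤`: the coarsest topology for which all linear maps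
`H^∞ → H`, `ξ ↦ dU(x₁) ⋯ dU(x_k) ξ`, are continuous. (By multilinearity it is enough to let the
`x_i` run through a basis of `𝔤`.) -/
instance : TopologicalSpace (SmoothVec E U) :=
  ⨅ L : List (GroupLieAlgebra 𝓘(ℝ, E) G),
    TopologicalSpace.induced (fun ξ : SmoothVec E U => derivedWord U L ξ.val) inferInstance

variable (E) in
/-- The space `H^{-∞}` of distribution vectors: the continuous antilinear functionals on `H^∞`,
with the weak-* topology, that is, the topology of pointwise convergence on `H^∞`. -/
abbrev DistVec (U : G →* (H ≃ₗᵢ[ℂ] H)) : Type _ :=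
  SmoothVec E U →SLₚₜ[starRingEnd ℂ] ℂ

section Group

variable [LieGroup 𝓘(ℝ, E) ∞ G]

/-- `Ad(g⁻¹) x`, the derivative at `1` of the conjugation `a ↦ g⁻¹ a g` in the direction `x`. -/
def adInv (g : G) (x : GroupLieAlgebra 𝓘(ℝ, E) G) : GroupLieAlgebra 𝓘(ℝ, E) G :=
  mfderiv 𝓘(ℝ, E) 𝓘(ℝ, E) (fun a : G => g⁻¹ * a * g) 1 x

lemma contMDiff_conj (g : G) :
    ContMDiff 𝓘(ℝ, E) 𝓘(ℝ, E) ∞ (fun a : G => g⁻¹ * a * g) :=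
  (contMDiff_mul_right (I := 𝓘(ℝ, E)) (n := ∞) (a := g)).comp
    (contMDiff_mul_left (I := 𝓘(ℝ, E)) (n := ∞) (a := g⁻¹))

lemma smoothVectors_map (g : G) {ξ : H} (hξ : ξ ∈ smoothVectors E U) :
    U g ξ ∈ smoothVectors E U := by
  have h : ContMDiff 𝓘(ℝ, E) 𝓘(ℝ, H) ∞ (fun a => U a ξ) := hξ
  have h2 := h.comp (contMDiff_mul_right (I := 𝓘(ℝ, E)) (n := ∞) (a := g))
  show ContMDiff 𝓘(ℝ, E) 𝓘(ℝ, H) ∞ (fun a => U a (U g ξ))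
  convert h2 using 2 with a
  simp [map_mul]

lemma derivedRep_map (g : G) (x : GroupLieAlgebra 𝓘(ℝ, E) G) (ζ : H) :
    derivedRep U x (U g ζ) = U g (derivedRep U (adInv g x) ζ) := by
  set f : G → H := fun a => U a ζ with hf
  set L : G → H →L[ℝ] H := fun b => (U b).toContinuousLinearEquiv.toContinuousLinearMap.restrictScalars ℝ
    with hL
  have hLd : ∀ (b : G) (v : H), MDifferentiableAt 𝓘(ℝ, H) 𝓘(ℝ, H) (L b) v := fun b v =>
    (L b).differentiableAt.mdifferentiableAt
  have hc : ∀ b : G, MDifferentiableAt 𝓘(ℝ, E) 𝓘(ℝ, E) (fun a : G => b⁻¹ * a * b) 1 := fun b =>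
    (contMDiff_conj (E := E) b 1).mdifferentiableAt (by simp)
  have key : (fun a => U a (U g ζ)) = L g ∘ (f ∘ fun a : G => g⁻¹ * a * g) := by
    funext a
    show (U a * U g) ζ = (U g * U (g⁻¹ * a * g)) ζ
    rw [← map_mul, ← map_mul]
    congr 2
    group
  have key' : f = L g⁻¹ ∘ ((fun a => U a (U g ζ)) ∘ fun a : G => g⁻¹⁻¹ * a * g⁻¹) := by
    funext a
    show U a ζ = (U g⁻¹ * (U (g⁻¹⁻¹ * a * g⁻¹) * U g)) ζ
    rw [← map_mul, ← map_mul]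
    congr 2
    group
  by_cases hd : MDifferentiableAt 𝓘(ℝ, E) 𝓘(ℝ, H) f 1
  · have h1 : g⁻¹ * 1 * g = 1 := by group
    have hfc : MDifferentiableAt 𝓘(ℝ, E) 𝓘(ℝ, H) (f ∘ fun a : G => g⁻¹ * a * g) 1 :=
      MDifferentiableAt.comp_of_eq 1 (y := 1) hd (hc g) h1
    unfold derivedRep adInv
    rw [key]
    have e1 := mfderiv_comp_apply 1 (hLd g _) hfc x
    have e2 := mfderiv_comp_apply_of_eq 1 hd (hc g) h1 x
    rw [mfderiv_eq_fderiv, ContinuousLinearMap.fderiv] at e1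
    exact e1.trans (congrArg (L g) e2)
  · have hd' : ¬ MDifferentiableAt 𝓘(ℝ, E) 𝓘(ℝ, H) (fun a => U a (U g ζ)) 1 := by
      intro hcontra
      apply hd
      rw [key']
      have h1 : g⁻¹⁻¹ * 1 * g⁻¹ = 1 := by group
      exact (hLd g⁻¹ _).comp 1 (MDifferentiableAt.comp_of_eq 1 (y := 1) hcontra (hc g⁻¹) h1)
    unfold derivedRep
    rw [mfderiv_zero_of_not_mdifferentiableAt hd, mfderiv_zero_of_not_mdifferentiableAt hd']
    exact (map_zero (U g)).symm

lemma derivedWord_map (g : G) (L : List (GroupLieAlgebra 𝓘(ℝ, E) G)) (ξ : H) :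
    derivedWord U L (U g ξ) = U g (derivedWord U (L.map (adInv g)) ξ) := by
  induction L with
  | nil => rfl
  | cons x L ih =>
    show derivedRep U x (derivedWord U L (U g ξ)) = _
    rw [ih, derivedRep_map]
    rfl

/-- The operator `U^∞(g)`, the restriction of `U g` to `H^∞`. -/
def smoothAct (U : G →* (H ≃ₗᵢ[ℂ] H)) (g : G) : SmoothVec E U →L[ℂ] SmoothVec E U where
  toFun ξ := ⟨U g ξ.val, smoothVectors_map g ξ.2⟩
  map_add' ξ ζ := Subtype.ext (map_add (U g) ξ.val ζ.val)
  map_smul' c ξ := Subtype.ext (map_smul (U g) c ξ.val)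
  cont := by
    refine continuous_iInf_rng.2 fun L => continuous_induced_rng.2 ?_
    have h : Continuous fun ξ : SmoothVec E U => derivedWord U (L.map (adInv g)) ξ.val :=
      continuous_iInf_dom continuous_induced_dom
    exact ((U g).continuous.comp h).congr fun ξ => (derivedWord_map g L ξ.val).symm

/-- The operator `U^{-∞}(g)` on `H^{-∞}`, `⟨ξ, U^{-∞}(g) η⟩ = ⟨U^∞(g⁻¹) ξ, η⟩`. -/
def distAct (U : G →* (H ≃ₗᵢ[ℂ] H)) (g : G) (η : DistVec E U) : DistVec E U :=
  ContinuousLinearMap.comp (σ₁₂ := RingHom.id ℂ) (σ₂₃ := starRingEnd ℂ) (σ₁₃ := starRingEnd ℂ) η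
    (smoothAct U g⁻¹)

/-- The one-parameter group `t ↦ U^∞(exp(t h))` on `H^∞`. -/
def smoothFlow (U : G →* (H ≃ₗᵢ[ℂ] H)) (h : GroupLieAlgebra 𝓘(ℝ, E) G) (t : ℝ) :
    SmoothVec E U → SmoothVec E U :=
  smoothAct U (lieExp (t • h))

/-- The one-parameter group `t ↦ U^{-∞}(exp(t h))` on `H^{-∞}`. -/
def distFlow (U : G →* (H ≃ₗᵢ[ℂ] H)) (h : GroupLieAlgebra 𝓘(ℝ, E) G) (t : ℝ) :
    DistVec E U → DistVec E U :=
  distAct U (lieExp (t • h))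

/-- The restriction `J^∞` to `H^∞` of a map `J` preserving `H^∞`. -/
def smoothConj (J : H → H) (hJ : ∀ ξ ∈ smoothVectors E U, J ξ ∈ smoothVectors E U)
    (ξ : SmoothVec E U) : SmoothVec E U :=
  ⟨J ξ.val, hJ _ ξ.2⟩

/-- `J^{-∞} η = conj ∘ η ∘ J^∞`, as a functional on `H^∞`. -/
def distConj (J : H → H) (hJ : ∀ ξ ∈ smoothVectors E U, J ξ ∈ smoothVectors E U)
    (η : DistVec E U) : SmoothVec E U → ℂ :=
  fun ξ => starRingEnd ℂ (η (smoothConj J hJ ξ))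

/-- The space `H^{-∞}_KMS`: the distribution vectors `η` whose orbit map `t ↦ U^{-∞}(exp(t h)) η`
extends to the strip `0 ≤ Im z ≤ π`, with value `J^{-∞} η` at `iπ`. -/
def kmsSpace (U : G →* (H ≃ₗᵢ[ℂ] H)) (h : GroupLieAlgebra 𝓘(ℝ, E) G) (J : H → H)
    (hJ : ∀ ξ ∈ smoothVectors E U, J ξ ∈ smoothVectors E U) : Set (DistVec E U) :=
  {η | η ∈ extDomain (distFlow U h) Real.pi ∧
    ⇑(extOp (distFlow U h) Real.pi η) = distConj J hJ η}

end Group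

/-- The annihilator of a set `S` of smooth vectors with respect to the real duality pairing
`(ξ, η) ↦ Re ⟨ξ, η⟩ = Re (η ξ)`. -/
def realAnnihilator (S : Set (SmoothVec E U)) : Set (DistVec E U) :=
  {η | ∀ ξ ∈ S, (η ξ).re = 0}

end Rep

end LieRep

end

open scoped Topology

noncomputable section

namespace LieRep

open MeasureTheory Filter

/-! ### One-parameter subgroups of a Lie group -/

section ExpCurve

variable {E : Type*} [NormedAddCommGroup E] [NormedSpace ℝ E]
  {G : Type*} [TopologicalSpace G] [ChartedSpace E G] [Group G] [LieGroup 𝓘(ℝ, E) ∞ G]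

/-! Write `U_t` for the flow on H^∞. The inclusion of the KMS space in the annihilator is a duality
argument. If F extends the orbit of η and f that of ξ, then z ↦ F(z)(ξ) and z ↦ η(f(-z̄)) are both
holomorphic on the strip (η is antilinear) and both equal η(U_{-t} ξ) on the real line, so they
agree at iπ, a fixed point of z ↦ -z̄ (`IsOrbitExtension.pairing`). The KMS condition then says that
η(U_{iπ} ξ) is the conjugate of η(Jξ), and the difference of a number and its conjugate is purely
imaginary.

Conversely, let η be in the annihilator. Testing with ξ and iξ gives η(U_{iπ} ξ) = conj η(Jξ) for
all ξ in the domain (`eq_conj_of_mem_kmsAnnihilator`). A general ξ is replaced by Gaussian averages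
ξ_n of its orbit. These converge to ξ in H^∞ and have entire orbits z ↦ U_z ξ_n, so Φ_n(z) = conj
η(U_z ξ_n) is entire. Its boundary values involve only conj η(U_t ξ_n) and, by the annihilator
identity, η(U_t (Jξ)_n). Both converge uniformly after division by some exp(K|t|), because the flow
grows at most exponentially in each Sobolev seminorm. Phragmén–Lindelöf carries the convergence into
the strip (`exists_strip_limit`). For fixed z the limit, as a functional of ξ, is again continuous
by Banach–Steinhaus, and F(z)(ξ) = conj Ψ_ξ(-z̄), with Ψ_ξ = lim Φ_n, is the required extension of
the orbit of η, with value J^{-∞} η at iπ. Annihilators are closed real subspaces, which settles the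
rest.

The analytic input about H^∞ is that it is complete and metrizable, that integrals of suitable
H^∞-valued functions exist in it, and that orbits are continuous in its topology. All three rest on
studying orbit maps in the chart at the identity: the derived representation is closed
(`HasOrbitDeriv.of_tendsto`), a set of vectors stable under it consists of smooth vectors
(`mem_smoothVectors_of_stable`), and Ad(g⁻¹) tends to the identity as g tends to 1
(`tendsto_adCLM`). -/

instance lieGroup_minSmoothness : LieGroup 𝓘(ℝ, E) (minSmoothness ℝ 3) G := by
  rw [minSmoothness_of_isRCLikeNormedField]
  exact LieGroup.of_le (I := 𝓘(ℝ, E)) (n := ∞) (WithTop.coe_le_coe.2 le_top)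

lemma isManifold_one : IsManifold 𝓘(ℝ, E) 1 G :=
  IsManifold.of_le (n := ∞) (by exact_mod_cast le_top)

lemma contMDiff_one_mulInvariantVectorField (x : GroupLieAlgebra 𝓘(ℝ, E) G) :
    ContMDiff 𝓘(ℝ, E) 𝓘(ℝ, E).tangent 1
      (fun g => (⟨g, mulInvariantVectorField x g⟩ : TangentBundle 𝓘(ℝ, E) G)) :=
  (contMDiff_mulInvariantVectorField x).of_le (by simp [minSmoothness_of_isRCLikeNormedField])

/-- Left translation of the left invariant vector field. -/
lemma mfderiv_mul_left_mulInvariantVectorField (x : GroupLieAlgebra 𝓘(ℝ, E) G) (g a : G) :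
    mfderiv 𝓘(ℝ, E) 𝓘(ℝ, E) (fun b : G => g * b) a (mulInvariantVectorField x a) =
      mulInvariantVectorField x (g * a) := by
  have h1 : MDifferentiableAt 𝓘(ℝ, E) 𝓘(ℝ, E) (fun b : G => g * b) a :=
    (contMDiff_mul_left (I := 𝓘(ℝ, E)) (n := ∞) (a := g)).contMDiffAt.mdifferentiableAt (by simp)
  have h2 : MDifferentiableAt 𝓘(ℝ, E) 𝓘(ℝ, E) (fun b : G => a * b) 1 :=
    (contMDiff_mul_left (I := 𝓘(ℝ, E)) (n := ∞) (a := a)).contMDiffAt.mdifferentiableAt (by simp)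
  have h3 := mfderiv_comp_apply_of_eq 1 h1 h2 (mul_one a) x
  have h4 : ((fun b : G => g * b) ∘ fun b : G => a * b) = fun b => g * a * b := by
    funext b; simp [mul_assoc]
  rw [h4] at h3
  exact h3.symm

lemma isMIntegralCurveOn_mul_left {x : GroupLieAlgebra 𝓘(ℝ, E) G} {γ : ℝ → G} {s : Set ℝ}
    (hγ : IsMIntegralCurveOn γ (mulInvariantVectorField x) s) (g : G) :
    IsMIntegralCurveOn (fun t => g * γ t) (mulInvariantVectorField x) s := by
  intro t ht
  have h1 : MDifferentiableAt 𝓘(ℝ, E) 𝓘(ℝ, E) (fun b : G => g * b) (γ t) :=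
    (contMDiff_mul_left (I := 𝓘(ℝ, E)) (n := ∞) (a := g)).contMDiffAt.mdifferentiableAt (by simp)
  have h2 := h1.hasMFDerivAt.comp_hasMFDerivWithinAt t (hγ t ht)
  have h3 : ContinuousLinearMap.smulRight (1 : ℝ →L[ℝ] ℝ) (mulInvariantVectorField x (g * γ t)) =
      (mfderiv 𝓘(ℝ, E) 𝓘(ℝ, E) (fun b : G => g * b) (γ t)).comp
        (ContinuousLinearMap.smulRight (1 : ℝ →L[ℝ] ℝ) (mulInvariantVectorField x (γ t))) := by
    refine ContinuousLinearMap.ext fun r => ?_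
    rw [← mfderiv_mul_left_mulInvariantVectorField]
    exact (map_smul (mfderiv 𝓘(ℝ, E) 𝓘(ℝ, E) (fun b : G => g * b) (γ t)) r
      (mulInvariantVectorField x (γ t))).symm
  exact h3 ▸ h2

variable [CompleteSpace E] [T2Space G]

/-- Left translates of a local integral curve through 1 are integral curves through every g with the
same lifetime ε, and a uniform lifetime forces completeness. -/
lemma exists_isMIntegralCurve_mulInvariantVectorField (x : GroupLieAlgebra 𝓘(ℝ, E) G) :
    ∃ γ : ℝ → G, γ 0 = 1 ∧ IsMIntegralCurve γ (mulInvariantVectorField x) := by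
  have : IsManifold 𝓘(ℝ, E) 1 G := isManifold_one
  obtain ⟨γ, h0, hγ⟩ := exists_isMIntegralCurveAt_of_contMDiffAt_boundaryless 0
    (contMDiff_one_mulInvariantVectorField x).contMDiffAt (x₀ := (1 : G))
  obtain ⟨ε, hε, hγ⟩ := isMIntegralCurveAt_iff'.1 hγ
  refine exists_isMIntegralCurve_of_isMIntegralCurveOn (contMDiff_one_mulInvariantVectorField x)
    hε (fun g => ⟨fun t => g * γ t, by simp [h0], ?_⟩) 1
  rw [Real.ball_eq_Ioo, zero_sub, zero_add] at hγ
  exact isMIntegralCurveOn_mul_left hγ g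

/-- The rescaled curve s ↦ γ(st) is integral for t • x, so uniqueness identifies it with the curve
chosen in `lieExp`. -/
lemma lieExp_smul_eq {x : GroupLieAlgebra 𝓘(ℝ, E) G} {γ : ℝ → G} (h0 : γ 0 = 1)
    (hγ : IsMIntegralCurve γ (mulInvariantVectorField x)) (t : ℝ) : lieExp (t • x) = γ t := by
  have : IsManifold 𝓘(ℝ, E) 1 G := isManifold_one
  have hex := exists_isMIntegralCurve_mulInvariantVectorField (t • x)
  rw [lieExp, dif_pos hex]
  have h1 := hγ.comp_mul t
  have h2 : mulInvariantVectorField (t • x) = t • mulInvariantVectorField x :=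
    mulInvariantVectorField_smul (I := 𝓘(ℝ, E)) t x
  have := isMIntegralCurve_Ioo_eq_of_contMDiff_boundaryless (t₀ := 0)
    (contMDiff_one_mulInvariantVectorField (t • x)) hex.choose_spec.2 (h2 ▸ h1)
    (by simp [hex.choose_spec.1, h0])
  rw [this]; simp

variable (x : GroupLieAlgebra 𝓘(ℝ, E) G)

lemma lieExp_add_smul (s t : ℝ) : lieExp ((s + t) • x) = lieExp (s • x) * lieExp (t • x) := by
  have : IsManifold 𝓘(ℝ, E) 1 G := isManifold_one
  obtain ⟨γ, h0, hγ⟩ := exists_isMIntegralCurve_mulInvariantVectorField x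
  simp only [lieExp_smul_eq h0 hγ]
  have h1 := hγ.comp_add s
  have h2 : IsMIntegralCurve (fun t => γ s * γ t) (mulInvariantVectorField x) := by
    rw [isMIntegralCurve_iff_isMIntegralCurveOn] at hγ ⊢
    exact isMIntegralCurveOn_mul_left hγ _
  have := isMIntegralCurve_Ioo_eq_of_contMDiff_boundaryless (t₀ := 0)
    (contMDiff_one_mulInvariantVectorField x) h1 h2 (by simp [h0])
  simpa [add_comm] using congrFun this t

lemma lieExp_zero_smul : lieExp ((0 : ℝ) • x) = 1 := by
  obtain ⟨γ, h0, hγ⟩ := exists_isMIntegralCurve_mulInvariantVectorField x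
  rw [lieExp_smul_eq h0 hγ, h0]

lemma lieExp_neg_smul (t : ℝ) : lieExp ((-t) • x) = (lieExp (t • x))⁻¹ := by
  rw [eq_inv_iff_mul_eq_one, ← lieExp_add_smul, neg_add_cancel, lieExp_zero_smul]

lemma continuous_lieExp_smul : Continuous fun t : ℝ => lieExp (t • x) := by
  obtain ⟨γ, h0, hγ⟩ := exists_isMIntegralCurve_mulInvariantVectorField x
  simp only [lieExp_smul_eq h0 hγ]
  exact continuous_iff_continuousAt.2 fun t => (hγ t).continuousAt

end ExpCurve

/-! ### Group operations and adjoint action in the chart at the identity -/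

section Chart

variable (E : Type*) [NormedAddCommGroup E] [NormedSpace ℝ E]
  (G : Type*) [TopologicalSpace G] [ChartedSpace E G] [Group G]

/-- The coordinates of the identity in the chart at the identity. -/
def chartOne : E := extChartAt 𝓘(ℝ, E) (1 : G) 1

/-- The inverse of the chart at the identity. -/
def ofChart : E → G := (extChartAt 𝓘(ℝ, E) (1 : G)).symm

variable {E G}

lemma ofChart_chartOne : ofChart E G (chartOne E G) = 1 := extChartAt_to_inv (I := 𝓘(ℝ, E)) 1

lemma eventually_ofChart_extChartAt :
    ∀ᶠ g in 𝓝 (1 : G), ofChart E G (extChartAt 𝓘(ℝ, E) (1 : G) g) = g := by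
  filter_upwards [extChartAt_source_mem_nhds (I := 𝓘(ℝ, E)) (1 : G)] with g hg
  exact (extChartAt 𝓘(ℝ, E) (1 : G)).left_inv hg

lemma eventually_extChartAt_ofChart :
    ∀ᶠ u in 𝓝 (chartOne E G), extChartAt 𝓘(ℝ, E) (1 : G) (ofChart E G u) = u := by
  filter_upwards [extChartAt_target_mem_nhds (I := 𝓘(ℝ, E)) (1 : G)] with u hu
  exact (extChartAt 𝓘(ℝ, E) (1 : G)).right_inv hu

variable [LieGroup 𝓘(ℝ, E) ∞ G]

omit [LieGroup 𝓘(ℝ, E) ∞ G] in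
lemma contMDiffAt_chart [IsManifold 𝓘(ℝ, E) ∞ G] : ContMDiffAt 𝓘(ℝ, E) 𝓘(ℝ, E) ∞ (extChartAt 𝓘(ℝ, E) (1 : G)) 1 :=
  contMDiffAt_extChartAt

lemma contMDiffAt_ofChart : ContMDiffAt 𝓘(ℝ, E) 𝓘(ℝ, E) ∞ (ofChart E G) (chartOne E G) :=
  (contMDiffOn_extChartAt_symm (I := 𝓘(ℝ, E)) (1 : G)).contMDiffAt
    (extChartAt_target_mem_nhds (I := 𝓘(ℝ, E)) (1 : G))

/-- A map into the group that is smooth near a point where its value is `1` is smooth in the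
chart at the identity. -/
lemma contDiffAt_chart_comp {W : Type*} [NormedAddCommGroup W] [NormedSpace ℝ W] {f : W → G}
    {w : W} (hf : ContMDiffAt 𝓘(ℝ, W) 𝓘(ℝ, E) ∞ f w) (hw : f w = 1) :
    ContDiffAt ℝ ∞ (fun z => extChartAt 𝓘(ℝ, E) (1 : G) (f z)) w :=
  contMDiffAt_iff_contDiffAt.1 (ContMDiffAt.comp_of_eq (contMDiffAt_chart (G := G)) hf hw)

/-- `(u, w) ↦ u⁻¹ w` in the chart at the identity. -/
def chartInvMul (u w : E) : E := extChartAt 𝓘(ℝ, E) (1 : G) ((ofChart E G u)⁻¹ * ofChart E G w)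

/-- `(u, w) ↦ u w` in the chart at the identity. -/
def chartMul (u w : E) : E := extChartAt 𝓘(ℝ, E) (1 : G) (ofChart E G u * ofChart E G w)

/-- `(u, w) ↦ u⁻¹ w u` in the chart at the identity. -/
def chartConj (u w : E) : E :=
  extChartAt 𝓘(ℝ, E) (1 : G) ((ofChart E G u)⁻¹ * ofChart E G w * ofChart E G u)

lemma contMDiffAt_ofChart_fst : ContMDiffAt 𝓘(ℝ, E × E) 𝓘(ℝ, E) ∞
    (fun p : E × E => ofChart E G p.1) (chartOne E G, chartOne E G) :=
  ContMDiffAt.comp_of_eq (contMDiffAt_ofChart (G := G))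
    (contMDiffAt_iff_contDiffAt.2 contDiffAt_fst) rfl

lemma contMDiffAt_ofChart_snd : ContMDiffAt 𝓘(ℝ, E × E) 𝓘(ℝ, E) ∞
    (fun p : E × E => ofChart E G p.2) (chartOne E G, chartOne E G) :=
  ContMDiffAt.comp_of_eq (contMDiffAt_ofChart (G := G))
    (contMDiffAt_iff_contDiffAt.2 contDiffAt_snd) rfl

lemma contDiffAt_chartInvMul : ContDiffAt ℝ ∞ (Function.uncurry (chartInvMul (E := E) (G := G)))
    (chartOne E G, chartOne E G) :=
  contDiffAt_chart_comp (contMDiffAt_ofChart_fst.inv.mul contMDiffAt_ofChart_snd)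
    (by simp)

lemma contDiffAt_chartMul : ContDiffAt ℝ ∞ (Function.uncurry (chartMul (E := E) (G := G)))
    (chartOne E G, chartOne E G) :=
  contDiffAt_chart_comp (contMDiffAt_ofChart_fst.mul contMDiffAt_ofChart_snd)
    (by simp [ofChart_chartOne])

lemma contDiffAt_chartConj : ContDiffAt ℝ ∞ (Function.uncurry (chartConj (E := E) (G := G)))
    (chartOne E G, chartOne E G) :=
  contDiffAt_chart_comp
    ((contMDiffAt_ofChart_fst.inv.mul contMDiffAt_ofChart_snd).mul contMDiffAt_ofChart_fst)
    (by simp [ofChart_chartOne])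

omit [LieGroup 𝓘(ℝ, E) ∞ G] in
lemma chartInvMul_self (u : E) : chartInvMul (G := G) u u = chartOne E G := by
  simp [chartInvMul, chartOne]

/-- The logarithmic derivative at `u` of the inverse of the chart at the identity. -/
def logDeriv (u : E) : E →L[ℝ] E := fderiv ℝ (chartInvMul (G := G) u) u

lemma contDiffAt_logDeriv : ContDiffAt ℝ ∞ (logDeriv (E := E) (G := G)) (chartOne E G) :=
  ContDiffAt.fderiv (f := chartInvMul (G := G)) (g := id) (n := ∞) contDiffAt_chartInvMul
    contDiffAt_id (by simp)

omit [LieGroup 𝓘(ℝ, E) ∞ G] in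
lemma logDeriv_chartOne : logDeriv (G := G) (chartOne E G) = ContinuousLinearMap.id ℝ E := by
  have h : chartInvMul (G := G) (chartOne E G) =ᶠ[𝓝 (chartOne E G)] id := by
    filter_upwards [eventually_extChartAt_ofChart (E := E) (G := G)] with u hu
    simpa [chartInvMul, ofChart_chartOne] using hu
  rw [logDeriv, h.fderiv_eq, fderiv_id]

lemma eventually_differentiableAt_chartInvMul :
    ∀ᶠ u in 𝓝 (chartOne E G), DifferentiableAt ℝ (chartInvMul (E := E) (G := G) u) u := by
  have h1 := (contDiffAt_chartInvMul (E := E) (G := G)).of_le (m := 1)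
    (by exact_mod_cast le_top)
  have h2 := h1.eventually (by simp)
  have h3 : Filter.Tendsto (fun u : E => (u, u)) (𝓝 (chartOne E G))
      (𝓝 (chartOne E G, chartOne E G)) := by
    exact (continuous_id.prodMk continuous_id).tendsto _
  filter_upwards [h3.eventually h2] with u hu
  have h4 : DifferentiableAt ℝ (Function.uncurry (chartInvMul (E := E) (G := G))) (u, u) :=
    hu.differentiableAt (by simp)
  exact h4.comp u (f := fun w => (u, w)) ((differentiableAt_const u).prodMk differentiableAt_id)

/-- The adjoint action in the chart at the identity. -/
def chartAd (u : E) : E →L[ℝ] E := fderiv ℝ (chartConj (G := G) u) (chartOne E G)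

lemma continuousAt_chartAd : ContinuousAt (chartAd (E := E) (G := G)) (chartOne E G) :=
  (ContDiffAt.fderiv (f := chartConj (G := G)) (g := fun _ => chartOne E G) (n := ∞) (m := 0)
    contDiffAt_chartConj contDiffAt_const (by simp)).continuousAt

omit [LieGroup 𝓘(ℝ, E) ∞ G] in
lemma chartAd_chartOne : chartAd (G := G) (chartOne E G) = ContinuousLinearMap.id ℝ E := by
  have h : chartConj (G := G) (chartOne E G) =ᶠ[𝓝 (chartOne E G)] id := by
    filter_upwards [eventually_extChartAt_ofChart (E := E) (G := G)] with u hu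
    simpa [chartConj, ofChart_chartOne] using hu
  rw [chartAd, h.fderiv_eq, fderiv_id]

variable (E) in
/-- `Ad(g⁻¹)` as a continuous linear map of the model space. -/
def adCLM (g : G) : E →L[ℝ] E := mfderiv 𝓘(ℝ, E) 𝓘(ℝ, E) (fun a : G => g⁻¹ * a * g) 1

omit [LieGroup 𝓘(ℝ, E) ∞ G] in
lemma adInv_eq_adCLM (g : G) : adInv (E := E) g = adCLM E g := rfl

/-- Conjugation fixes 1, so its manifold derivative there is computed with the chart at 1 on both
sides. This makes Ad accessible to joint smoothness of `chartConj`. -/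
lemma adCLM_ofChart (u : E) : adCLM E (ofChart E G u) = chartAd (G := G) u := by
  have h1 : (ofChart E G u)⁻¹ * 1 * ofChart E G u = 1 := by group
  have hd : MDifferentiableAt 𝓘(ℝ, E) 𝓘(ℝ, E)
      (fun a : G => (ofChart E G u)⁻¹ * a * ofChart E G u) 1 :=
    (contMDiff_conj (E := E) (ofChart E G u) 1).mdifferentiableAt (by simp)
  have h2 := hd.hasMFDerivAt.2
  simp only [writtenInExtChartAt, modelWithCornersSelf_coe, Set.range_id, h1] at h2
  have h3 : HasFDerivWithinAt (chartConj (G := G) u) (adCLM E (ofChart E G u)) Set.univ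
    (chartOne E G) := h2
  rw [chartAd, (hasFDerivWithinAt_univ.1 h3).fderiv]

/-- The adjoint action converges to the identity at the identity. -/
lemma tendsto_adCLM : Filter.Tendsto (adCLM E (G := G)) (𝓝 1) (𝓝 (ContinuousLinearMap.id ℝ E)) := by
  have h1 := (continuousAt_chartAd (E := E) (G := G))
  rw [ContinuousAt, chartAd_chartOne] at h1
  have h3 : ContinuousAt (extChartAt 𝓘(ℝ, E) (1 : G)) 1 := contMDiffAt_chart.continuousAt
  refine (h1.comp h3).congr' ?_
  filter_upwards [eventually_ofChart_extChartAt (E := E) (G := G)] with g hg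
  rw [Function.comp_apply, ← adCLM_ofChart, hg]

end Chart

/-! ### Linear maps determined by their values on a basis -/

section BasisExt

variable (E : Type*) [NormedAddCommGroup E] [NormedSpace ℝ E] [FiniteDimensional ℝ E]
  (H : Type*) [NormedAddCommGroup H] [NormedSpace ℝ H]

/-- The `i`-th basis vector of the model space. -/
def basisVec (i : Fin (Module.finrank ℝ E)) : E := Module.finBasis ℝ E i

/-- The `i`-th coordinate on the model space. -/
def basisCoord (i : Fin (Module.finrank ℝ E)) : E →L[ℝ] ℝ :=
  LinearMap.toContinuousLinearMap ((Module.finBasis ℝ E).coord i)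

/-- The linear map with prescribed values on the basis vectors. -/
def basisExt : (Fin (Module.finrank ℝ E) → H) →L[ℝ] (E →L[ℝ] H) :=
  ∑ i, (ContinuousLinearMap.smulRightL ℝ E H (basisCoord E i)).comp (ContinuousLinearMap.proj i)

variable {E H}

lemma sum_basisCoord_smul (x : E) : ∑ i, basisCoord E i x • basisVec E i = x :=
  (Module.finBasis ℝ E).sum_repr x

lemma basisExt_apply (v : Fin (Module.finrank ℝ E) → H) (x : E) :
    basisExt E H v x = ∑ i, basisCoord E i x • v i := by
  simp [basisExt]

/-- Reduces smoothness, convergence and integrability of operator-valued derivatives to the same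
properties of finitely many vectors. -/
lemma basisExt_comp (D : E →L[ℝ] H) : basisExt E H (fun i => D (basisVec E i)) = D := by
  ext x
  rw [basisExt_apply]
  conv_rhs => rw [← sum_basisCoord_smul x]
  simp

end BasisExt

/-! ### Derivatives of orbit maps and criteria for smooth vectors -/

section Orbit

variable {E : Type*} [NormedAddCommGroup E] [NormedSpace ℝ E]
  {G : Type*} [TopologicalSpace G] [ChartedSpace E G] [Group G]
  {H : Type*} [NormedAddCommGroup H] [InnerProductSpace ℂ H]

/-- `U g` as a real continuous linear map. -/
def repCLM (U : G →* (H ≃ₗᵢ[ℂ] H)) (g : G) : H →L[ℝ] H :=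
  (U g).toContinuousLinearEquiv.toContinuousLinearMap.restrictScalars ℝ

omit [TopologicalSpace G] in
lemma rep_mul_apply (U : G →* (H ≃ₗᵢ[ℂ] H)) (g a : G) (ξ : H) : U (g * a) ξ = U g (U a ξ) := by
  rw [map_mul]; rfl

omit [TopologicalSpace G] in
lemma repCLM_apply (U : G →* (H ≃ₗᵢ[ℂ] H)) (g : G) (ξ : H) : repCLM U g ξ = U g ξ := rfl

omit [TopologicalSpace G] in
lemma norm_repCLM_le (U : G →* (H ≃ₗᵢ[ℂ] H)) (g : G) : ‖repCLM U g‖ ≤ 1 :=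
  ContinuousLinearMap.opNorm_le_bound _ zero_le_one fun ξ => by simp [repCLM_apply]

variable (E) in
/-- The orbit map of `ξ` in the chart at the identity. -/
def orbitChart (U : G →* (H ≃ₗᵢ[ℂ] H)) (ξ : H) (u : E) : H := U (ofChart E G u) ξ

/-- `D` is the derivative at the identity of the orbit map of `ξ`. -/
def HasOrbitDeriv (U : G →* (H ≃ₗᵢ[ℂ] H)) (ξ : H) (D : E →L[ℝ] H) : Prop :=
  HasFDerivAt (orbitChart E U ξ) D (chartOne E G)

variable {U : G →* (H ≃ₗᵢ[ℂ] H)}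

lemma HasOrbitDeriv.hasMFDerivAt {ξ : H} {D : E →L[ℝ] H} (h : HasOrbitDeriv U ξ D) :
    HasMFDerivAt 𝓘(ℝ, E) 𝓘(ℝ, H) (fun g => U g ξ) 1 D := by
  constructor
  · have h1 : ContinuousAt (orbitChart E U ξ) (extChartAt 𝓘(ℝ, E) (1 : G) 1) := h.continuousAt
    have h2 := ContinuousAt.comp (x := (1 : G)) h1 (continuousAt_extChartAt (I := 𝓘(ℝ, E)) (1 : G))
    refine h2.congr ?_
    filter_upwards [eventually_ofChart_extChartAt (E := E) (G := G)] with g hg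
    simp only [Function.comp_apply, orbitChart, hg]
  · simp only [writtenInExtChartAt, modelWithCornersSelf_coe, Set.range_id]
    exact HasFDerivAt.hasFDerivWithinAt h

lemma HasOrbitDeriv.derivedRep {ξ : H} {D : E →L[ℝ] H} (h : HasOrbitDeriv U ξ D) (x : E) :
    derivedRep U x ξ = D x := by
  have := h.hasMFDerivAt.mfderiv
  unfold LieRep.derivedRep
  rw [this]
  rfl

variable [LieGroup 𝓘(ℝ, E) ∞ G]

/-- By U(g)ξ = U(g₀) U(g₀⁻¹g)ξ, smoothness at the identity propagates to every g₀. -/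
lemma mem_smoothVectors_iff {ξ : H} :
    ξ ∈ smoothVectors E U ↔ ContDiffAt ℝ ∞ (orbitChart E U ξ) (chartOne E G) := by
  constructor
  · intro h
    have h1 : ContMDiff 𝓘(ℝ, E) 𝓘(ℝ, H) ∞ (fun g => U g ξ) := h
    exact contMDiffAt_iff_contDiffAt.1 (h1.contMDiffAt.comp _ (contMDiffAt_ofChart (G := G)))
  · intro h g₀
    have h1 : ContMDiffAt 𝓘(ℝ, E) 𝓘(ℝ, E) ∞
        (fun g : G => extChartAt 𝓘(ℝ, E) (1 : G) (g₀⁻¹ * g)) g₀ :=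
      ContMDiffAt.comp_of_eq (contMDiffAt_chart (G := G))
        (contMDiff_mul_left (I := 𝓘(ℝ, E)) (n := ∞) (a := g₀⁻¹)).contMDiffAt (by simp)
    have h2 : ContMDiffAt 𝓘(ℝ, E) 𝓘(ℝ, H) ∞ (repCLM U g₀ ∘ orbitChart E U ξ) (chartOne E G) :=
      contMDiffAt_iff_contDiffAt.2 ((repCLM U g₀).contDiff.contDiffAt.comp _ h)
    have h3 := ContMDiffAt.comp_of_eq h2 h1 (by simp [chartOne])
    refine h3.congr_of_eventuallyEq ?_
    have h4 : Filter.Tendsto (fun g : G => g₀⁻¹ * g) (𝓝 g₀) (𝓝 1) := by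
      have : ContinuousAt (fun g : G => g₀⁻¹ * g) g₀ :=
        (contMDiff_mul_left (I := 𝓘(ℝ, E)) (n := ∞) (a := g₀⁻¹)).continuous.continuousAt
      simpa [ContinuousAt] using this
    filter_upwards [h4.eventually (eventually_ofChart_extChartAt (E := E) (G := G))] with g hg
    simp only [Function.comp_apply, repCLM_apply, orbitChart, hg]
    rw [← rep_mul_apply]
    simp

lemma exists_hasOrbitDeriv {ξ : H} (h : ξ ∈ smoothVectors E U) :
    ∃ D : E →L[ℝ] H, HasOrbitDeriv U ξ D :=
  ⟨_, ((mem_smoothVectors_iff.1 h).differentiableAt (by simp)).hasFDerivAt⟩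

lemma eventually_ofChart_mul_chartInvMul : ∀ᶠ u in 𝓝 (chartOne E G), ∀ᶠ w in 𝓝 u,
    ofChart E G u * ofChart E G (chartInvMul (G := G) u w) = ofChart E G w := by
  have h1 : Filter.Tendsto (fun p : E × E => (ofChart E G p.1)⁻¹ * ofChart E G p.2)
      (𝓝 (chartOne E G, chartOne E G)) (𝓝 1) := by
    have := (contMDiffAt_ofChart_fst (E := E) (G := G)).inv.mul contMDiffAt_ofChart_snd
    have := this.continuousAt
    rw [ContinuousAt] at this
    simpa using! this
  have h2 := (h1.eventually (eventually_ofChart_extChartAt (E := E) (G := G))).eventually_nhds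
  have h3 : Filter.Tendsto (fun u : E => (u, u)) (𝓝 (chartOne E G))
      (𝓝 (chartOne E G, chartOne E G)) := (continuous_id.prodMk continuous_id).tendsto _
  filter_upwards [h3.eventually h2] with u hu
  have h4 : Filter.Tendsto (fun w : E => (u, w)) (𝓝 u) (𝓝 (u, u)) :=
    (continuous_const.prodMk continuous_id).tendsto _
  filter_upwards [h4.eventually hu] with w hw
  rw [chartInvMul, hw]; simp

/-- The derivative at the identity determines the derivative of the orbit map nearby. -/
lemma eventually_hasFDerivAt_orbitChart : ∀ᶠ u in 𝓝 (chartOne E G), ∀ (ξ : H) (D : E →L[ℝ] H),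
    HasOrbitDeriv U ξ D → HasFDerivAt (orbitChart E U ξ)
      ((repCLM U (ofChart E G u)).comp (D.comp (logDeriv (G := G) u))) u := by
  filter_upwards [eventually_ofChart_mul_chartInvMul (E := E) (G := G),
    eventually_differentiableAt_chartInvMul (E := E) (G := G)] with u hu hd ξ D hD
  -- Near u the orbit map is U(u) applied to the orbit map at u⁻¹w; the chain rule at w = u uses
  -- only the derivative at the identity. The neighbourhood depends on neither ξ nor D.
  have h1 : HasFDerivAt (orbitChart E U ξ) D (chartInvMul (G := G) u u) := by
    rw [chartInvMul_self]; exact hD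
  have h2 := ((repCLM U (ofChart E G u)).hasFDerivAt.comp u (h1.comp u hd.hasFDerivAt))
  refine h2.congr_of_eventuallyEq ?_
  filter_upwards [hu] with w hw
  simp only [Function.comp_apply, repCLM_apply, orbitChart]
  rw [← rep_mul_apply, hw]

/-- Closedness of the derived representation. Near the identity the derivatives U(u) ∘ D_i ∘
`logDeriv u` converge uniformly, since U(u) is isometric and `logDeriv` is locally bounded, so limit
and derivative may be exchanged. -/
lemma HasOrbitDeriv.of_tendsto {ι : Type*} {l : Filter ι} [l.NeBot] {ξ : ι → H}
    {D : ι → E →L[ℝ] H} {ξ₀ : H} {D₀ : E →L[ℝ] H} (h : ∀ i, HasOrbitDeriv U (ξ i) (D i))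
    (hξ : Filter.Tendsto ξ l (𝓝 ξ₀)) (hD : Filter.Tendsto D l (𝓝 D₀)) :
    HasOrbitDeriv U ξ₀ D₀ := by
  have h1 : ∀ᶠ u in 𝓝 (chartOne E G), ‖logDeriv (G := G) u‖ < ‖logDeriv (G := G) (chartOne E G)‖ + 1 :=
    (contDiffAt_logDeriv (E := E) (G := G)).continuousAt.norm.eventually_lt_const (by linarith)
  obtain ⟨s, hs, hso, hs0⟩ := eventually_nhds_iff.1
    (h1.and (eventually_hasFDerivAt_orbitChart (E := E) (G := G) (U := U)))
  set C := ‖logDeriv (G := G) (chartOne E G)‖ + 1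
  have hC : 0 < C := by positivity
  have key := hasFDerivAt_of_tendstoUniformlyOn (𝕜 := ℝ) (l := l) hso
    (f := fun i => orbitChart E U (ξ i)) (g := orbitChart E U ξ₀)
    (f' := fun i u => (repCLM U (ofChart E G u)).comp ((D i).comp (logDeriv (G := G) u)))
    (g' := fun u => (repCLM U (ofChart E G u)).comp (D₀.comp (logDeriv (G := G) u)))
    ?_ (fun i u hu => (hs u hu).2 _ _ (h i))
    (fun u _ => ((repCLM U (ofChart E G u)).continuous.tendsto _).comp hξ) hs0
  · rw [logDeriv_chartOne, ofChart_chartOne] at key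
    have e : (repCLM U (1 : G)).comp (D₀.comp (ContinuousLinearMap.id ℝ E)) = D₀ := by
      ext x; simp [repCLM_apply]
    rwa [e] at key
  · rw [Metric.tendstoUniformlyOn_iff]
    intro ε hε
    filter_upwards [(tendsto_iff_norm_sub_tendsto_zero.1 hD).eventually_lt_const
      (show (0 : ℝ) < ε / C by positivity)] with i hi u hu
    rw [dist_comm, dist_eq_norm, ← ContinuousLinearMap.comp_sub, ← ContinuousLinearMap.sub_comp]
    calc _ ≤ ‖repCLM U (ofChart E G u)‖ * (‖D i - D₀‖ * ‖logDeriv (G := G) u‖) :=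
          (ContinuousLinearMap.opNorm_comp_le _ _).trans
            (mul_le_mul_of_nonneg_left (ContinuousLinearMap.opNorm_comp_le _ _) (norm_nonneg _))
      _ ≤ 1 * (‖D i - D₀‖ * C) := by
          gcongr
          · exact norm_repCLM_le _ _
          · exact (hs u hu).1.le
      _ < ε := by rw [one_mul]; exact (lt_div_iff₀ hC).1 hi

omit [LieGroup 𝓘(ℝ, E) ∞ G] in
lemma HasOrbitDeriv.add {ξ ζ : H} {D D' : E →L[ℝ] H} (h : HasOrbitDeriv U ξ D)
    (h' : HasOrbitDeriv U ζ D') : HasOrbitDeriv U (ξ + ζ) (D + D') := by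
  refine (HasFDerivAt.add h h').congr_of_eventuallyEq (Filter.Eventually.of_forall fun u => ?_)
  simp [orbitChart]

omit [LieGroup 𝓘(ℝ, E) ∞ G] in
lemma HasOrbitDeriv.smul {ξ : H} {D : E →L[ℝ] H} (c : ℂ) (h : HasOrbitDeriv U ξ D) :
    HasOrbitDeriv U (c • ξ) (c • D) := by
  refine (HasFDerivAt.const_smul h c).congr_of_eventuallyEq (Filter.Eventually.of_forall fun u => ?_)
  simp [orbitChart]

variable [FiniteDimensional ℝ E]

/-- A set of vectors that is stable under the derived representation consists of smooth
vectors. -/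
lemma mem_smoothVectors_of_stable {S : Set H}
    (hS : ∀ ξ ∈ S, ∃ D : E →L[ℝ] H, HasOrbitDeriv U ξ D ∧ ∀ x, D x ∈ S) {ξ : H} (hξ : ξ ∈ S) :
    ξ ∈ smoothVectors E U := by
  rw [mem_smoothVectors_iff, contDiffAt_infty]
  intro n
  induction n generalizing ξ with
  | zero =>
    obtain ⟨D, hD, -⟩ := hS ξ hξ
    rw [Nat.cast_zero, contDiffAt_zero]
    refine ⟨_, eventually_hasFDerivAt_orbitChart (U := U), fun u hu => ?_⟩
    exact (hu ξ D hD).continuousAt.continuousWithinAt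
  | succ n ih =>
    obtain ⟨D, hD, hDS⟩ := hS ξ hξ
    rw [Nat.cast_succ, contDiffAt_succ_iff_hasFDerivAt]
    -- Expanded in a basis, the derivative consists of orbit maps of vectors of S, which are C^n by
    -- induction, composed with the smooth `logDeriv`; hence the orbit map is C^(n+1).
    refine ⟨fun u => (basisExt E H fun i => orbitChart E U (D (basisVec E i)) u).comp
      (logDeriv (G := G) u), ⟨_, eventually_hasFDerivAt_orbitChart (U := U), fun u hu => ?_⟩, ?_⟩
    · have := hu ξ D hD
      rw [← ContinuousLinearMap.comp_assoc,
        ← basisExt_comp ((repCLM U (ofChart E G u)).comp D)] at this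
      exact this
    · refine ContDiffAt.clm_comp ?_ ((contDiffAt_logDeriv (E := E) (G := G)).of_le
        (by exact_mod_cast le_top))
      exact (basisExt E H).contDiff.contDiffAt.comp _
        (contDiffAt_pi.2 fun i => ih (hDS _))

omit [FiniteDimensional ℝ E] in
-- U(u) D x is the partial derivative at w = 1, in the direction x, of the jointly smooth map (u, w)
-- ↦ U(uw)ξ, hence smooth in u.
lemma HasOrbitDeriv.mem_smoothVectors {ξ : H} {D : E →L[ℝ] H} (hξ : ξ ∈ smoothVectors E U)
    (h : HasOrbitDeriv U ξ D) (x : E) : D x ∈ smoothVectors E U := by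
  rw [mem_smoothVectors_iff] at hξ ⊢
  have h0 : chartMul (G := G) (chartOne E G) (chartOne E G) = chartOne E G := by
    rw [chartMul, ofChart_chartOne, mul_one]; rfl
  have h1 : ContDiffAt ℝ ∞ (Function.uncurry fun u w : E =>
      orbitChart E U ξ (chartMul (G := G) u w)) (chartOne E G, chartOne E G) := by
    have : ContDiffAt ℝ ∞ (orbitChart E U ξ)
        (Function.uncurry (chartMul (E := E) (G := G)) (chartOne E G, chartOne E G)) := by
      rw [Function.uncurry_apply_pair, h0]; exact hξ
    exact this.comp (chartOne E G, chartOne E G) contDiffAt_chartMul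
  have h2 : ContDiffAt ℝ ∞ (fun u : E => fderiv ℝ (fun w =>
      orbitChart E U ξ (chartMul (G := G) u w)) (chartOne E G) x) (chartOne E G) :=
    (ContDiffAt.fderiv (n := ∞) h1 contDiffAt_const (by simp)).clm_apply contDiffAt_const
  refine h2.congr_of_eventuallyEq ?_
  have h3 : Filter.Tendsto (fun p : E × E => ofChart E G p.1 * ofChart E G p.2)
      (𝓝 (chartOne E G, chartOne E G)) (𝓝 1) := by
    have := ((contMDiffAt_ofChart_fst (E := E) (G := G)).mul contMDiffAt_ofChart_snd).continuousAt
    rw [ContinuousAt] at this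
    simpa [ofChart_chartOne] using! this
  have h4 := h3.eventually (eventually_ofChart_extChartAt (E := E) (G := G))
  filter_upwards [(h4.eventually_nhds.curry_nhds).mono fun u hu => hu.self_of_nhds] with u hu
  have h5 : Filter.Tendsto (fun w : E => (u, w)) (𝓝 (chartOne E G)) (𝓝 (u, chartOne E G)) :=
    (continuous_const.prodMk continuous_id).tendsto _
  have h6 : HasFDerivAt (fun w => orbitChart E U ξ (chartMul (G := G) u w))
      ((repCLM U (ofChart E G u)).comp D) (chartOne E G) := by
    refine ((repCLM U (ofChart E G u)).hasFDerivAt.comp _ h).congr_of_eventuallyEq ?_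
    filter_upwards [h5.eventually hu] with w hw
    simp only [Function.comp_apply, repCLM_apply, orbitChart]
    rw [← rep_mul_apply, chartMul, hw]
  rw [h6.fderiv]; rfl

end Orbit

/-! ### The topology of H^∞: Sobolev seminorms and continuity of orbits -/

section Smooth

variable {E : Type*} [NormedAddCommGroup E] [NormedSpace ℝ E]
  {G : Type*} [TopologicalSpace G] [ChartedSpace E G] [Group G]
  {H : Type*} [NormedAddCommGroup H] [InnerProductSpace ℂ H]
  {U : G →* (H ≃ₗᵢ[ℂ] H)}

variable (E U) in
/-- The inclusion of the smooth vectors as a linear map. -/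
def SmoothVec.valLM : SmoothVec E U →ₗ[ℂ] H where
  toFun := SmoothVec.val
  map_add' _ _ := rfl
  map_smul' _ _ := rfl

lemma SmoothVec.ext {ξ ζ : SmoothVec E U} (h : ξ.val = ζ.val) : ξ = ζ := Subtype.ext h

@[simp] lemma SmoothVec.val_add (ξ ζ : SmoothVec E U) : (ξ + ζ).val = ξ.val + ζ.val := rfl
@[simp] lemma SmoothVec.val_sub (ξ ζ : SmoothVec E U) : (ξ - ζ).val = ξ.val - ζ.val := rfl
@[simp] lemma SmoothVec.val_smul (c : ℂ) (ξ : SmoothVec E U) : (c • ξ).val = c • ξ.val := rfl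
@[simp] lemma SmoothVec.val_zero : (0 : SmoothVec E U).val = 0 := rfl

variable [LieGroup 𝓘(ℝ, E) ∞ G]

/-- The derivative at the identity of the orbit map of a smooth vector. -/
def orbitDeriv (ξ : SmoothVec E U) : E →L[ℝ] H := (exists_hasOrbitDeriv ξ.2).choose

lemma hasOrbitDeriv (ξ : SmoothVec E U) : HasOrbitDeriv U ξ.val (orbitDeriv ξ) :=
  (exists_hasOrbitDeriv ξ.2).choose_spec

lemma HasOrbitDeriv.eq_orbitDeriv {ξ : SmoothVec E U} {D : E →L[ℝ] H}
    (h : HasOrbitDeriv U ξ.val D) : D = orbitDeriv ξ :=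
  HasFDerivAt.unique h (hasOrbitDeriv ξ)

/-- The derived representation on smooth vectors. -/
def smoothRep (U : G →* (H ≃ₗᵢ[ℂ] H)) (x : E) : SmoothVec E U →ₗ[ℂ] SmoothVec E U where
  toFun ξ := ⟨orbitDeriv ξ x, (hasOrbitDeriv ξ).mem_smoothVectors ξ.2 x⟩
  map_add' ξ ζ := SmoothVec.ext <| by
    have := ((hasOrbitDeriv ξ).add (hasOrbitDeriv ζ)).eq_orbitDeriv (ξ := ξ + ζ)
    exact (DFunLike.congr_fun this x).symm
  map_smul' c ξ := SmoothVec.ext <| by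
    have := ((hasOrbitDeriv ξ).smul c).eq_orbitDeriv (ξ := c • ξ)
    exact (DFunLike.congr_fun this x).symm

lemma val_smoothRep (x : E) (ξ : SmoothVec E U) : (smoothRep U x ξ).val = orbitDeriv ξ x := rfl

lemma derivedRep_val (x : E) (ξ : SmoothVec E U) :
    derivedRep U x ξ.val = (smoothRep U x ξ).val :=
  (hasOrbitDeriv ξ).derivedRep x

/-- Words in the derived representation on smooth vectors. -/
def smoothWord (U : G →* (H ≃ₗᵢ[ℂ] H)) (L : List E) : SmoothVec E U →ₗ[ℂ] SmoothVec E U :=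
  L.foldr (fun x T => (smoothRep U x).comp T) LinearMap.id

lemma smoothWord_cons (x : E) (L : List E) (ξ : SmoothVec E U) :
    smoothWord U (x :: L) ξ = smoothRep U x (smoothWord U L ξ) := rfl

lemma derivedWord_val (L : List E) (ξ : SmoothVec E U) :
    derivedWord U L ξ.val = (smoothWord U L ξ).val := by
  induction L with
  | nil => rfl
  | cons x L ih =>
    rw [smoothWord_cons, ← derivedRep_val, ← ih]
    rfl

lemma smoothWord_append_singleton (x : E) (L : List E) (ξ : SmoothVec E U) :
    smoothWord U (L ++ [x]) ξ = smoothWord U L (smoothRep U x ξ) := by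
  induction L with
  | nil => rfl
  | cons y L ih => rw [List.cons_append, smoothWord_cons, ih]; rfl

lemma smoothRep_smoothAct (g : G) (x : E) (ξ : SmoothVec E U) :
    smoothRep U x (smoothAct U g ξ) = smoothAct U g (smoothRep U (adCLM E g x) ξ) := by
  apply SmoothVec.ext
  rw [← derivedRep_val]
  have := derivedRep_map (U := U) g x ξ.val
  rw [adInv_eq_adCLM] at this
  exact this.trans (congrArg (U g) (derivedRep_val _ _))

/-- The seminorm `ξ ↦ ‖dU(x₁) ⋯ dU(x_k) ξ‖`. -/
def wordSeminorm (U : G →* (H ≃ₗᵢ[ℂ] H)) (L : List E) : Seminorm ℂ (SmoothVec E U) :=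
  (normSeminorm ℂ H).comp ((SmoothVec.valLM E U).comp (smoothWord U L))

lemma wordSeminorm_apply (L : List E) (ξ : SmoothVec E U) :
    wordSeminorm U L ξ = ‖(smoothWord U L ξ).val‖ := rfl

/-- The index `Fin 1` is that of the single norm of H, pulled back along each word. -/
lemma withSeminorms_sigma : WithSeminorms (SeminormFamily.sigma
    fun (L : List E) (_ : Fin 1) => wordSeminorm U L) := by
  have h : ∀ L : List E, WithSeminorms (topology := TopologicalSpace.induced
      (fun ξ : SmoothVec E U => derivedWord U L ξ.val) inferInstance)
      (fun _ : Fin 1 => wordSeminorm U L) := by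
    intro L
    have := LinearMap.withSeminorms_induced (norm_withSeminorms ℂ H)
      ((SmoothVec.valLM E U).comp (smoothWord U L))
    have e : (fun ξ : SmoothVec E U => derivedWord U L ξ.val) =
        ((SmoothVec.valLM E U).comp (smoothWord U L)) := funext fun ξ => derivedWord_val L ξ
    rw [e]
    exact this
  exact withSeminorms_iInf h

lemma withSeminorms_wordSeminorm : WithSeminorms (wordSeminorm (E := E) U) := by
  refine withSeminorms_sigma.congr ?_ ?_
  · exact fun L => ⟨{⟨L, 0⟩}, 1, by simp [SeminormFamily.sigma, Seminorm.comp_id]⟩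
  · exact fun L => ⟨{L.1}, 1, by simp [SeminormFamily.sigma, Seminorm.comp_id]⟩

instance : IsTopologicalAddGroup (SmoothVec E U) :=
  (withSeminorms_wordSeminorm (E := E) (U := U)).topologicalAddGroup

instance : ContinuousSMul ℂ (SmoothVec E U) :=
  (withSeminorms_wordSeminorm (E := E) (U := U)).continuousSMul

lemma continuous_wordSeminorm (L : List E) : Continuous (wordSeminorm U L) :=
  (withSeminorms_wordSeminorm (E := E) (U := U)).continuous_seminorm L

variable (U) in
/-- Words in the derived representation as continuous maps `H^∞ → H`. -/
def wordCLM (L : List E) : SmoothVec E U →L[ℂ] H where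
  toLinearMap := (SmoothVec.valLM E U).comp (smoothWord U L)
  cont := (continuous_iInf_dom (i := L) continuous_induced_dom).congr fun ξ => derivedWord_val L ξ

lemma wordCLM_apply (L : List E) (ξ : SmoothVec E U) : wordCLM U L ξ = (smoothWord U L ξ).val := rfl

lemma wordCLM_cons (x : E) (L : List E) (ξ : SmoothVec E U) :
    wordCLM U (x :: L) ξ = orbitDeriv (smoothWord U L ξ) x := rfl

lemma continuous_smoothRep (x : E) : Continuous (smoothRep U x) := by
  refine WithSeminorms.continuous_of_isBounded withSeminorms_wordSeminorm withSeminorms_wordSeminorm _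
    fun L => ⟨{L ++ [x]}, 1, fun ξ => ?_⟩
  simp [wordSeminorm_apply, smoothWord_append_singleton]

variable [FiniteDimensional ℝ E]

variable (U) in
/-- An increasing sequence of seminorms defining the topology of the smooth vectors. -/
def sobolev : ℕ → Seminorm ℂ (SmoothVec E U)
  | 0 => wordSeminorm U []
  | n + 1 => sobolev n + ∑ i, (sobolev n).comp (smoothRep U (basisVec E i))

lemma sobolev_zero (ξ : SmoothVec E U) : sobolev (E := E) U 0 ξ = ‖ξ.val‖ := rfl

lemma sobolev_succ (n : ℕ) (ξ : SmoothVec E U) : sobolev U (n + 1) ξ =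
    sobolev U n ξ + ∑ i, sobolev U n (smoothRep U (basisVec E i) ξ) := by
  simp [sobolev]

lemma sobolev_mono : Monotone (sobolev (E := E) U) :=
  monotone_nat_of_le_succ fun n ξ => by
    rw [sobolev_succ]
    exact le_add_of_nonneg_right (Finset.sum_nonneg fun i _ => apply_nonneg _ _)

lemma sobolev_smoothRep_basisVec_le (n : ℕ) (i) (ξ : SmoothVec E U) :
    sobolev U n (smoothRep U (basisVec E i) ξ) ≤ sobolev U (n + 1) ξ := by
  rw [sobolev_succ]
  exact (Finset.single_le_sum (f := fun i => sobolev U n (smoothRep U (basisVec E i) ξ))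
    (fun i _ => apply_nonneg _ _) (Finset.mem_univ i)).trans
    (le_add_of_nonneg_left (apply_nonneg _ _))

variable (E) in
/-- The sum of the norms of the coordinate functionals. -/
def coordBound : ℝ := ∑ i, ‖basisCoord E i‖

lemma coordBound_nonneg : 0 ≤ coordBound E := Finset.sum_nonneg fun _ _ => norm_nonneg _

lemma smoothRep_eq_sum (x : E) (ξ : SmoothVec E U) :
    smoothRep U x ξ = ∑ i, (basisCoord E i x : ℂ) • smoothRep U (basisVec E i) ξ := by
  apply SmoothVec.ext
  have h : (∑ i, (basisCoord E i x : ℂ) • smoothRep U (basisVec E i) ξ).val =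
      ∑ i, (basisCoord E i x : ℂ) • (smoothRep U (basisVec E i) ξ).val := by
    have := map_sum (SmoothVec.valLM E U)
      (fun i => (basisCoord E i x : ℂ) • smoothRep U (basisVec E i) ξ) Finset.univ
    exact this
  rw [h, val_smoothRep]
  conv_lhs => rw [← sum_basisCoord_smul x]
  simp [val_smoothRep]

lemma sobolev_smoothRep_le (n : ℕ) (x : E) (ξ : SmoothVec E U) :
    sobolev U n (smoothRep U x ξ) ≤ coordBound E * ‖x‖ * sobolev U (n + 1) ξ := by
  rw [smoothRep_eq_sum]
  refine (Finset.le_sum_of_subadditive (sobolev U n) (map_zero _).le (map_add_le_add _) _ _).trans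
    ?_
  rw [coordBound, Finset.sum_mul, Finset.sum_mul]
  refine Finset.sum_le_sum fun i _ => ?_
  rw [map_smul_eq_mul, Complex.norm_real]
  exact mul_le_mul ((basisCoord E i).le_opNorm x) (sobolev_smoothRep_basisVec_le n i ξ)
    (apply_nonneg _ _) (by positivity)

lemma continuous_sobolev (n : ℕ) : Continuous (sobolev (E := E) U n) := by
  induction n with
  | zero => exact continuous_wordSeminorm _
  | succ n ih =>
    have : ⇑(sobolev (E := E) U (n + 1)) = fun ξ => sobolev U n ξ +
        ∑ i, sobolev U n (smoothRep U (basisVec E i) ξ) := funext fun ξ => sobolev_succ n ξ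
    rw [this]
    exact ih.add (continuous_finsetSum _ fun i _ => ih.comp (continuous_smoothRep _))

lemma exists_wordSeminorm_le (L : List E) : ∃ C : ℝ, ∀ ξ : SmoothVec E U,
    wordSeminorm U L ξ ≤ C * sobolev U L.length ξ := by
  -- The last letter acts first: removing it replaces ξ by dU(x)ξ and costs one Sobolev order.
  induction L using List.reverseRecOn with
  | nil => exact ⟨1, fun ξ => by rw [one_mul]; rfl⟩
  | append_singleton L x ih =>
    obtain ⟨C, hC⟩ := ih
    refine ⟨|C| * (coordBound E * ‖x‖), fun ξ => ?_⟩
    have h1 := hC (smoothRep U x ξ)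
    rw [wordSeminorm_apply] at h1 ⊢
    rw [smoothWord_append_singleton, List.length_append, List.length_singleton, mul_assoc]
    refine h1.trans ((mul_le_mul_of_nonneg_right (le_abs_self C) (apply_nonneg _ _)).trans ?_)
    exact mul_le_mul_of_nonneg_left (sobolev_smoothRep_le _ x ξ) (abs_nonneg C)

lemma withSeminorms_sobolev : WithSeminorms (sobolev (E := E) U) := by
  refine withSeminorms_wordSeminorm.congr (fun n => ?_) (Seminorm.IsBounded.of_real fun L => ?_)
  · obtain ⟨s, C, -, h⟩ := Seminorm.bound_of_continuous
      (withSeminorms_wordSeminorm (E := E) (U := U)) _ (continuous_sobolev n)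
    exact ⟨s, C, by simpa using h⟩
  · obtain ⟨C, hC⟩ := exists_wordSeminorm_le (U := U) L
    exact ⟨{L.length}, C, fun ξ => by simpa using hC ξ⟩

/-- A continuous seminorm is bounded by one of the Sobolev seminorms. -/
lemma exists_le_sobolev (p : Seminorm ℂ (SmoothVec E U)) (hp : Continuous p) :
    ∃ (n : ℕ) (C : ℝ), 0 ≤ C ∧ ∀ ξ, p ξ ≤ C * sobolev U n ξ := by
  obtain ⟨s, C, -, h⟩ := Seminorm.bound_of_continuous
    (withSeminorms_sobolev (E := E) (U := U)) p hp
  refine ⟨s.sup id, C, C.2, fun ξ => (h ξ).trans ?_⟩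
  refine mul_le_mul_of_nonneg_left ?_ C.2
  have : s.sup (sobolev U) ≤ sobolev (E := E) U (s.sup id) :=
    Finset.sup_le fun n hn => sobolev_mono (Finset.le_sup (f := id) hn)
  exact this ξ

/-- At order 0 the action is isometric. At each further order, moving dU(e_i) past U(g) turns e_i
into Ad(g⁻¹)e_i, which costs a factor controlled by R. -/
lemma exists_sobolev_smoothAct_le (n : ℕ) (R : ℝ) : ∃ C : ℝ, 0 ≤ C ∧ ∀ g : G, ‖adCLM E g‖ ≤ R →
    ∀ ξ : SmoothVec E U, sobolev U n (smoothAct U g ξ) ≤ C * sobolev U n ξ := by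
  induction n with
  | zero =>
    refine ⟨1, zero_le_one, fun g _ ξ => ?_⟩
    rw [sobolev_zero, sobolev_zero, one_mul]
    exact ((U g).norm_map ξ.val).le
  | succ n ih =>
    obtain ⟨C, hC0, hC⟩ := ih
    refine ⟨C + ∑ i, C * (coordBound E * (|R| * ‖basisVec E i‖)), ?_, fun g hg ξ => ?_⟩
    · have := coordBound_nonneg (E := E)
      positivity
    · rw [sobolev_succ, add_mul, Finset.sum_mul]
      refine add_le_add ((hC g hg ξ).trans (mul_le_mul_of_nonneg_left
        (sobolev_mono n.le_succ ξ) hC0)) (Finset.sum_le_sum fun i _ => ?_)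
      rw [smoothRep_smoothAct]
      refine (hC g hg _).trans ?_
      rw [mul_assoc]
      refine mul_le_mul_of_nonneg_left ((sobolev_smoothRep_le _ _ _).trans ?_) hC0
      refine mul_le_mul_of_nonneg_right (mul_le_mul_of_nonneg_left ?_ coordBound_nonneg)
        (apply_nonneg _ _)
      exact ((adCLM E g).le_opNorm _).trans (mul_le_mul_of_nonneg_right
        (hg.trans (le_abs_self R)) (norm_nonneg _))

omit [FiniteDimensional ℝ E] in
lemma eventually_norm_adCLM_le :
    ∀ᶠ g in 𝓝 (1 : G), ‖adCLM E g‖ ≤ ‖ContinuousLinearMap.id ℝ E‖ + 1 :=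
  (tendsto_adCLM (E := E) (G := G)).norm.eventually_le_const (by linarith)

omit [FiniteDimensional ℝ E] in
lemma smoothRep_sub (x y : E) (ξ : SmoothVec E U) :
    smoothRep U (x - y) ξ = smoothRep U x ξ - smoothRep U y ξ :=
  SmoothVec.ext (map_sub (orbitDeriv ξ) x y)

/-- The orbit maps are continuous at the identity in the topology of the smooth vectors. -/
lemma tendsto_sobolev_smoothAct_sub (hU : ∀ ξ : H, Continuous fun g => U g ξ) (n : ℕ)
    (ξ : SmoothVec E U) :
    Filter.Tendsto (fun g => sobolev U n (smoothAct U g ξ - ξ)) (𝓝 1) (𝓝 0) := by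
  induction n generalizing ξ with
  | zero =>
    have h1 : Continuous fun g => ‖U g ξ.val - ξ.val‖ := ((hU ξ.val).sub continuous_const).norm
    have h2 := h1.tendsto 1
    simpa using! h2
  | succ n ih =>
    obtain ⟨C, hC0, hC⟩ := exists_sobolev_smoothAct_le (E := E) (U := U) n
      (‖ContinuousLinearMap.id ℝ E‖ + 1)
    have h1 : ∀ i, Filter.Tendsto (fun g => C * (coordBound E *
        ‖adCLM E g (basisVec E i) - basisVec E i‖ * sobolev U (n + 1) ξ) +
        sobolev U n (smoothAct U g (smoothRep U (basisVec E i) ξ) - smoothRep U (basisVec E i) ξ))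
        (𝓝 1) (𝓝 0) := by
      intro i
      have h2 : Filter.Tendsto (fun g : G => ‖adCLM E g (basisVec E i) - basisVec E i‖)
          (𝓝 1) (𝓝 0) := by
        have := ((ContinuousLinearMap.apply ℝ E (basisVec E i)).continuous.tendsto _).comp
          (tendsto_adCLM (E := E) (G := G))
        simpa using! (tendsto_iff_norm_sub_tendsto_zero.1 this)
      simpa using (((h2.const_mul (coordBound E)).mul_const (sobolev U (n + 1) ξ)).const_mul C).add
        (ih (smoothRep U (basisVec E i) ξ))
    have h3 := (ih ξ).add (tendsto_finsetSum Finset.univ fun i _ => h1 i)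
    rw [Finset.sum_const_zero, add_zero] at h3
    refine tendsto_of_tendsto_of_tendsto_of_le_of_le' tendsto_const_nhds h3
      (Filter.Eventually.of_forall fun g => apply_nonneg _ _) ?_
    filter_upwards [eventually_norm_adCLM_le (E := E) (G := G)] with g hg
    rw [sobolev_succ]
    refine add_le_add le_rfl (Finset.sum_le_sum fun i _ => ?_)
    -- The first summand is small because Ad(g⁻¹) tends to the identity, the second by induction
    -- applied to dU(e_i)ξ.
    have e : smoothRep U (basisVec E i) (smoothAct U g ξ - ξ) =
        smoothAct U g (smoothRep U (adCLM E g (basisVec E i) - basisVec E i) ξ) +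
        (smoothAct U g (smoothRep U (basisVec E i) ξ) - smoothRep U (basisVec E i) ξ) := by
      rw [map_sub, smoothRep_smoothAct, smoothRep_sub, map_sub]; abel
    rw [e]
    refine (map_add_le_add _ _ _).trans (add_le_add ((hC g hg _).trans ?_) le_rfl)
    exact mul_le_mul_of_nonneg_left (sobolev_smoothRep_le _ _ _) hC0

end Smooth

/-! ### Integration and closed subspaces -/

/-- The integral of a function with values in a closed subspace lies in that subspace. -/
lemma integral_mem_closed_submodule {X : Type*} [MeasurableSpace X] {μ : Measure X}
    {B : Type*} [NormedAddCommGroup B] [NormedSpace ℝ B] [CompleteSpace B]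
    (K : Submodule ℝ B) (hK : IsClosed (K : Set B)) {f : X → B} (hf : Integrable f μ)
    (hfK : ∀ x, f x ∈ K) : ∫ x, f x ∂μ ∈ K := by
  have : CompleteSpace K := hK.completeSpace_coe
  let g : X → K := fun x => ⟨f x, hfK x⟩
  have hg : AEStronglyMeasurable g μ :=
    (Topology.IsEmbedding.subtypeVal.aestronglyMeasurable_comp_iff (g := ((↑) : K → B)) (f := g)).1
      hf.aestronglyMeasurable
  have hg' : Integrable g μ := hf.mono hg (Eventually.of_forall fun x => le_rfl)
  have := K.subtypeL.integral_comp_comm hg'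
  have e : ∫ x, f x ∂μ = ∫ x, K.subtypeL (g x) ∂μ := rfl
  rw [e, this]
  exact (∫ x, g x ∂μ).2

/-- If a linear map is dominated by another one that commutes with an integral, then it commutes
with the integral. -/
lemma map_eq_integral_of_dominated {X : Type*} [MeasurableSpace X] {μ : Measure X}
    {V B B' : Type*} [AddCommGroup V] [Module ℂ V]
    [NormedAddCommGroup B] [NormedSpace ℂ B] [CompleteSpace B]
    [NormedAddCommGroup B'] [NormedSpace ℂ B'] [CompleteSpace B']
    (A : V →ₗ[ℂ] B) (β : V →ₗ[ℂ] B') (C : ℝ) (hC : ∀ v, ‖β v‖ ≤ C * ‖A v‖) (f : X → V)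
    (hA : Integrable (fun x => A (f x)) μ) (hβ : Integrable (fun x => β (f x)) μ) (v : V)
    (hv : A v = ∫ x, A (f x) ∂μ) : β v = ∫ x, β (f x) ∂μ := by
  -- The integral of (A f, β f) lies in the closure of the range of (A, β). Along approximants w_n,
  -- A w_n → A v, so domination gives β w_n → β v, while β w_n also tends to the integral of β f. No
  -- topology on `V` is needed.
  have hT := integral_mem_closed_submodule
    ((LinearMap.range (A.prod β)).topologicalClosure.restrictScalars ℝ)
    (LinearMap.range (A.prod β)).isClosed_topologicalClosure (hA.prodMk hβ)
    fun x => (LinearMap.range (A.prod β)).le_topologicalClosure ⟨f x, rfl⟩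
  rw [integral_pair hA hβ, ← hv] at hT
  obtain ⟨y, hy, hyl⟩ := mem_closure_iff_seq_limit.1 hT
  choose w hw using hy
  have h1 : Tendsto (fun n => β (w n)) atTop (𝓝 (∫ x, β (f x) ∂μ)) :=
    ((continuous_snd.tendsto _).comp hyl).congr fun n => by rw [Function.comp_apply, ← hw n]; rfl
  have h2 : Tendsto (fun n => A (w n)) atTop (𝓝 (A v)) :=
    ((continuous_fst.tendsto _).comp hyl).congr fun n => by rw [Function.comp_apply, ← hw n]; rfl
  have h3 : Tendsto (fun n => β (w n)) atTop (𝓝 (β v)) := by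
    rw [tendsto_iff_norm_sub_tendsto_zero] at h2 ⊢
    refine squeeze_zero (fun n => norm_nonneg _) (fun n => ?_) (by simpa using h2.const_mul C)
    rw [← map_sub, ← map_sub]
    exact hC _
  exact tendsto_nhds_unique h3 h1

/-! ### Completeness of H^∞, Banach–Steinhaus, and H^∞-valued integrals -/

section Frechet

variable {E : Type*} [NormedAddCommGroup E] [NormedSpace ℝ E]
  {G : Type*} [TopologicalSpace G] [ChartedSpace E G] [Group G]
  {H : Type*} [NormedAddCommGroup H] [InnerProductSpace ℂ H]
  {U : G →* (H ≃ₗᵢ[ℂ] H)} [LieGroup 𝓘(ℝ, E) ∞ G] [FiniteDimensional ℝ E]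

omit [FiniteDimensional ℝ E] in
lemma tendsto_smoothVec_iff {ι : Type*} {l : Filter ι} {f : ι → SmoothVec E U}
    {ξ : SmoothVec E U} :
    Tendsto f l (𝓝 ξ) ↔ ∀ L, Tendsto (fun i => wordCLM U L (f i)) l (𝓝 (wordCLM U L ξ)) := by
  refine ⟨fun h L => ((wordCLM U L).continuous.tendsto _).comp h, fun h => ?_⟩
  rw [withSeminorms_wordSeminorm.tendsto_nhds]
  intro L ε hε
  filter_upwards [(tendsto_iff_norm_sub_tendsto_zero.1 (h L)).eventually_lt_const hε] with i hi
  rw [← map_sub] at hi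
  exact hi

/-- A family of vectors that is compatible with differentiation of orbit maps comes from a smooth
vector. -/
lemma exists_smoothVec_of_family (ζ : List E → H)
    (h : ∀ L, ∃ D : E →L[ℝ] H, HasOrbitDeriv U (ζ L) D ∧ ∀ x, D x = ζ (x :: L)) :
    ∃ ξ : SmoothVec E U, ∀ L, wordCLM U L ξ = ζ L := by
  have h1 : ∀ L, ζ L ∈ smoothVectors E U := fun L =>
    mem_smoothVectors_of_stable (S := Set.range ζ) (by
      rintro _ ⟨L, rfl⟩
      obtain ⟨D, hD, hD'⟩ := h L
      exact ⟨D, hD, fun x => ⟨_, (hD' x).symm⟩⟩) ⟨L, rfl⟩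
  set ξ : SmoothVec E U := ⟨ζ [], h1 []⟩
  refine ⟨ξ, fun L => ?_⟩
  induction L with
  | nil => rfl
  | cons x L ih =>
    obtain ⟨D, hD, hD'⟩ := h L
    rw [wordCLM_cons, ← hD', ← HasOrbitDeriv.eq_orbitDeriv (D := D)]
    rw [← wordCLM_apply, ih]
    exact hD

lemma orbitDeriv_smoothWord (L : List E) (ξ : SmoothVec E U) : orbitDeriv (smoothWord U L ξ) =
    basisExt E H fun i => wordCLM U (basisVec E i :: L) ξ :=
  (basisExt_comp _).symm

lemma hasOrbitDeriv_wordCLM (L : List E) (ξ : SmoothVec E U) : HasOrbitDeriv U (wordCLM U L ξ)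
    (basisExt E H fun i => wordCLM U (basisVec E i :: L) ξ) := by
  rw [← orbitDeriv_smoothWord]
  exact hasOrbitDeriv _

lemma basisExt_wordCLM_apply (L : List E) (ξ : SmoothVec E U) (x : E) :
    basisExt E H (fun i => wordCLM U (basisVec E i :: L) ξ) x = wordCLM U (x :: L) ξ := by
  rw [← orbitDeriv_smoothWord]; rfl

variable [CompleteSpace H]

/-- The words converge in H one by one. Closedness of the derived representation makes the limits a
compatible family, and such a family comes from a smooth vector. -/
lemma exists_tendsto_of_cauchySeq_wordCLM {u : ℕ → SmoothVec E U}
    (hu : ∀ L : List E, CauchySeq fun n => wordCLM U L (u n)) : ∃ ξ, Tendsto u atTop (𝓝 ξ) := by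
  choose ζ hζ using fun L => cauchySeq_tendsto_of_complete (hu L)
  obtain ⟨ξ, hξ⟩ := exists_smoothVec_of_family (U := U) ζ fun L => by
    have h1 : Tendsto (fun n => basisExt E H fun i => wordCLM U (basisVec E i :: L) (u n)) atTop
        (𝓝 (basisExt E H fun i => ζ (basisVec E i :: L))) :=
      ((basisExt E H).continuous.tendsto _).comp (tendsto_pi_nhds.2 fun i => hζ _)
    refine ⟨_, HasOrbitDeriv.of_tendsto (fun n => hasOrbitDeriv_wordCLM L (u n)) (hζ L) h1,
      fun x => ?_⟩
    refine tendsto_nhds_unique (((ContinuousLinearMap.apply ℝ H x).continuous.tendsto _).comp h1) ?_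
    refine (hζ (x :: L)).congr fun n => ?_
    exact (basisExt_wordCLM_apply L (u n) x).symm
  exact ⟨ξ, tendsto_smoothVec_iff.2 fun L => by rw [hξ]; exact hζ L⟩

/-- Countably many Sobolev seminorms and completeness make H^∞ a Fréchet space; the Baire property
is what Banach–Steinhaus requires. -/
instance : BaireSpace (SmoothVec E U) := by
  let _ : UniformSpace (SmoothVec E U) := IsTopologicalAddGroup.rightUniformSpace _
  have : IsUniformAddGroup (SmoothVec E U) := isUniformAddGroup_of_addCommGroup
  have : FirstCountableTopology (SmoothVec E U) :=
    (withSeminorms_sobolev (E := E) (U := U)).firstCountableTopology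
  have : (uniformity (SmoothVec E U)).IsCountablyGenerated :=
    IsUniformAddGroup.uniformity_countably_generated
  have : CompleteSpace (SmoothVec E U) := UniformSpace.complete_of_cauchySeq_tendsto fun u hu =>
    exists_tendsto_of_cauchySeq_wordCLM fun L => hu.map (wordCLM U L).uniformContinuous
  let _ := UniformSpace.pseudoMetricSpace (SmoothVec E U)
  infer_instance

/-- A pointwise limit of a sequence of distribution vectors is a distribution vector. -/
lemma exists_distVec_of_tendsto (g : ℕ → DistVec E U) (f : SmoothVec E U → ℂ)
    (h : ∀ ξ, Tendsto (fun n => g n ξ) atTop (𝓝 (f ξ))) : ∃ η : DistVec E U, ∀ ξ, η ξ = f ξ := by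
  let _ : UniformSpace (SmoothVec E U) := IsTopologicalAddGroup.rightUniformSpace _
  have : IsUniformAddGroup (SmoothVec E U) := isUniformAddGroup_of_addCommGroup
  let g' : ℕ → SmoothVec E U →SL[starRingEnd ℂ] ℂ := fun n => g n
  exact ⟨continuousLinearMapOfTendsto g' (f := f) (tendsto_pi_nhds.2 h), fun ξ => rfl⟩

open Classical in
/-- The integral of a function with values in the smooth vectors. -/
def smoothIntegral (f : ℝ → SmoothVec E U) : SmoothVec E U :=
  if h : ∃ I : SmoothVec E U, ∀ L, wordCLM U L I = ∫ t, wordCLM U L (f t) then h.choose else 0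

omit [CompleteSpace H] in
lemma integrable_comp_of_sobolev {f : ℝ → SmoothVec E U} (hc : Continuous f)
    (hf : ∀ n, Integrable fun t => sobolev U n (f t))
    {B : Type*} [NormedAddCommGroup B] [NormedSpace ℂ B] (β : SmoothVec E U →L[ℂ] B) :
    Integrable fun t => β (f t) := by
  obtain ⟨n, C, hC0, hC⟩ := exists_le_sobolev ((normSeminorm ℂ B).comp β.toLinearMap)
    (continuous_norm.comp β.continuous)
  refine ((hf n).const_mul C).mono' (β.continuous.comp hc).aestronglyMeasurable
    (Eventually.of_forall fun t => hC (f t))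

/-- Pairs (vector, derivative of its orbit map) form a closed subspace K of H × L(E, H), and
integration preserves K. The integrals of the words of f are therefore a compatible family, and the
default value in `smoothIntegral` does not occur. -/
lemma wordCLM_smoothIntegral {f : ℝ → SmoothVec E U} (hc : Continuous f)
    (hf : ∀ n, Integrable fun t => sobolev U n (f t)) (L : List E) :
    wordCLM U L (smoothIntegral f) = ∫ t, wordCLM U L (f t) := by
  have hi := fun L => integrable_comp_of_sobolev hc hf (wordCLM U L)
  have hex : ∃ I : SmoothVec E U, ∀ L, wordCLM U L I = ∫ t, wordCLM U L (f t) := by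
    refine exists_smoothVec_of_family _ fun L => ?_
    let K : Submodule ℝ (H × (E →L[ℝ] H)) :=
      { carrier := {p | HasOrbitDeriv U p.1 p.2}
        zero_mem' := by
          have := (hasOrbitDeriv (0 : SmoothVec E U)).smul 0
          simpa using this
        add_mem' := fun h h' => HasOrbitDeriv.add h h'
        smul_mem' := fun c p h => by simpa using HasOrbitDeriv.smul (c : ℂ) h }
    have hK : IsClosed (K : Set (H × (E →L[ℝ] H))) := by
      refine isClosed_of_closure_subset fun p hp => ?_
      obtain ⟨x, hx, hxp⟩ := mem_closure_iff_seq_limit.1 hp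
      exact HasOrbitDeriv.of_tendsto hx ((continuous_fst.tendsto _).comp hxp)
        ((continuous_snd.tendsto _).comp hxp)
    have hD : Integrable fun t => basisExt E H fun i => wordCLM U (basisVec E i :: L) (f t) :=
      (basisExt E H).integrable_comp (Integrable.of_eval fun i => hi _)
    refine ⟨∫ t, basisExt E H fun i => wordCLM U (basisVec E i :: L) (f t), ?_, fun x => ?_⟩
    · have := integral_mem_closed_submodule K hK ((hi L).prodMk hD)
        fun t => hasOrbitDeriv_wordCLM L (f t)
      rw [integral_pair (hi L) hD] at this
      exact this
    · rw [ContinuousLinearMap.integral_apply hD]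
      simp only [basisExt_wordCLM_apply]
  rw [smoothIntegral, dif_pos hex]
  exact hex.choose_spec L

/-- Continuous linear maps commute with integration of functions with values in the smooth
vectors. -/
lemma map_smoothIntegral {f : ℝ → SmoothVec E U} (hc : Continuous f)
    (hf : ∀ n, Integrable fun t => sobolev U n (f t))
    {B : Type*} [NormedAddCommGroup B] [NormedSpace ℂ B] [CompleteSpace B]
    (β : SmoothVec E U →L[ℂ] B) : β (smoothIntegral f) = ∫ t, β (f t) := by
  have hi := fun L => integrable_comp_of_sobolev hc hf (wordCLM U L)
  have hβ := integrable_comp_of_sobolev hc hf β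
  obtain ⟨s, C, -, hs⟩ := Seminorm.bound_of_continuous
    (withSeminorms_wordSeminorm (E := E) (U := U))
    ((normSeminorm ℂ B).comp β.toLinearMap) (continuous_norm.comp β.continuous)
  -- The finitely many words bounding β, gathered into one map; each commutes with the integral,
  -- hence so does `A`.
  let A : SmoothVec E U →L[ℂ] (s → H) := ContinuousLinearMap.pi fun L : s => wordCLM U L.1
  have hA : Integrable fun t => A (f t) := integrable_comp_of_sobolev hc hf A
  refine map_eq_integral_of_dominated A.toLinearMap β.toLinearMap C (fun ξ => (hs ξ).trans ?_) f
    hA hβ _ ?_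
  · refine mul_le_mul_of_nonneg_left (Seminorm.finset_sup_apply_le (norm_nonneg _) fun L hL => ?_)
      C.2
    exact norm_le_pi_norm (A ξ) ⟨L, hL⟩
  · funext L
    have h1 := (ContinuousLinearMap.proj (R := ℂ) (φ := fun _ : s => H) L).integral_comp_comm hA
    exact (wordCLM_smoothIntegral hc hf L.1).trans h1

end Frechet

/-! ### The flow on H^∞ and its exponential growth -/

section Flow

variable {E : Type*} [NormedAddCommGroup E] [NormedSpace ℝ E] [FiniteDimensional ℝ E]
  {G : Type*} [TopologicalSpace G] [T2Space G] [ChartedSpace E G] [Group G]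
  [LieGroup 𝓘(ℝ, E) ∞ G]
  {H : Type*} [NormedAddCommGroup H] [InnerProductSpace ℂ H]
  {U : G →* (H ≃ₗᵢ[ℂ] H)} (h : GroupLieAlgebra 𝓘(ℝ, E) G)

lemma smoothFlow_add (s t : ℝ) (ξ : SmoothVec E U) :
    smoothFlow U h (s + t) ξ = smoothFlow U h s (smoothFlow U h t ξ) := by
  have : CompleteSpace E := FiniteDimensional.complete ℝ E
  apply SmoothVec.ext
  show U (lieExp ((s + t) • h)) ξ.val = U (lieExp (s • h)) (U (lieExp (t • h)) ξ.val)
  rw [lieExp_add_smul, rep_mul_apply]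

lemma smoothFlow_zero (ξ : SmoothVec E U) : smoothFlow U h 0 ξ = ξ := by
  have : CompleteSpace E := FiniteDimensional.complete ℝ E
  apply SmoothVec.ext
  show U (lieExp ((0 : ℝ) • h)) ξ.val = ξ.val
  rw [lieExp_zero_smul, map_one]; rfl

lemma distFlow_apply (t : ℝ) (η : DistVec E U) (ξ : SmoothVec E U) :
    distFlow U h t η ξ = η (smoothFlow U h (-t) ξ) := by
  have : CompleteSpace E := FiniteDimensional.complete ℝ E
  unfold smoothFlow
  rw [lieExp_neg_smul]
  rfl

lemma tendsto_lieExp_smul_zero : Tendsto (fun t : ℝ => lieExp (t • h)) (𝓝 0) (𝓝 1) := by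
  have : CompleteSpace E := FiniteDimensional.complete ℝ E
  have := (continuous_lieExp_smul h).tendsto 0
  rwa [lieExp_zero_smul] at this

lemma continuous_smoothFlow (hU : ∀ ξ : H, Continuous fun g => U g ξ) (ξ : SmoothVec E U) :
    Continuous fun t => smoothFlow U h t ξ := by
  have h0 : Tendsto (fun t => smoothFlow U h t ξ) (𝓝 0) (𝓝 ξ) := by
    rw [withSeminorms_sobolev.tendsto_nhds]
    intro n ε hε
    exact ((tendsto_sobolev_smoothAct_sub hU n ξ).comp
      (tendsto_lieExp_smul_zero h)).eventually_lt_const hε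
  refine continuous_iff_continuousAt.2 fun t => ?_
  have h1 : Tendsto (fun s : ℝ => s - t) (𝓝 t) (𝓝 0) := by
    have : Continuous fun s : ℝ => s - t := by fun_prop
    simpa using this.tendsto t
  have h2 := ((smoothAct U (lieExp (t • h))).continuous.tendsto ξ).comp (h0.comp h1)
  refine h2.congr fun s => ?_
  have := smoothFlow_add (U := U) h t (s - t) ξ
  rw [add_sub_cancel] at this
  exact this.symm

/-- For |t| < δ the flow is bounded by some C ≥ 1. In general U_t is the m-th power of U_{t/m} with
m = ⌊|t|/δ⌋ + 1, and C^m ≤ C exp(K|t|) with K = log C / δ. -/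
lemma exists_sobolev_smoothFlow_le (n : ℕ) : ∃ C K : ℝ, 0 ≤ C ∧ 0 ≤ K ∧
    ∀ (t : ℝ) (ξ : SmoothVec E U),
      sobolev U n (smoothFlow U h t ξ) ≤ C * Real.exp (K * |t|) * sobolev U n ξ := by
  obtain ⟨C', -, hC'⟩ := exists_sobolev_smoothAct_le (E := E) (U := U) n
    (‖ContinuousLinearMap.id ℝ E‖ + 1)
  obtain ⟨δ, hδ, hδ'⟩ := Metric.eventually_nhds_iff.1
    ((tendsto_lieExp_smul_zero h).eventually (eventually_norm_adCLM_le (E := E) (G := G)))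
  set C := max C' 1
  have hC1 : 1 ≤ C := le_max_right _ _
  have hloc : ∀ t : ℝ, |t| < δ → ∀ ξ : SmoothVec E U,
      sobolev U n (smoothFlow U h t ξ) ≤ C * sobolev U n ξ := fun t ht ξ =>
    (hC' _ (hδ' (by simpa using ht)) ξ).trans
      (mul_le_mul_of_nonneg_right (le_max_left _ _) (apply_nonneg _ _))
  have hpow : ∀ (m : ℕ) (t : ℝ), |t| < δ → ∀ ξ : SmoothVec E U,
      sobolev U n (smoothFlow U h (m * t) ξ) ≤ C ^ m * sobolev U n ξ := by
    intro m t ht ξ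
    induction m with
    | zero => simp [smoothFlow_zero]
    | succ m ih =>
      rw [Nat.cast_succ, add_mul, one_mul, add_comm, smoothFlow_add, pow_succ', mul_assoc]
      exact (hloc t ht _).trans (mul_le_mul_of_nonneg_left ih (by positivity))
  refine ⟨C, Real.log C / δ, by positivity, div_nonneg (Real.log_nonneg hC1) hδ.le,
    fun t ξ => ?_⟩
  set m := ⌊|t| / δ⌋₊ + 1
  have hm : (0 : ℝ) < m := by positivity
  have h1 : |t / m| < δ := by
    rw [abs_div, abs_of_pos hm, div_lt_iff₀ hm, mul_comm, ← div_lt_iff₀ hδ]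
    exact_mod_cast Nat.lt_floor_add_one (|t| / δ)
  have h2 := hpow m (t / m) h1 ξ
  rw [mul_div_cancel₀ _ hm.ne'] at h2
  refine h2.trans (mul_le_mul_of_nonneg_right ?_ (apply_nonneg _ _))
  rw [pow_succ', ← Real.exp_log (show 0 < C by positivity), ← Real.exp_nat_mul,
    Real.exp_log (show 0 < C by positivity)]
  refine mul_le_mul_of_nonneg_left (Real.exp_le_exp.2 ?_) (by positivity)
  rw [div_mul_eq_mul_div, mul_div_assoc, mul_comm]
  exact mul_le_mul_of_nonneg_left (Nat.floor_le (by positivity)) (Real.log_nonneg hC1)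

end Flow

/-! ### Holomorphic functions on a strip -/

section StripAnalysis

lemma isOpen_openStrip (b : ℝ) : IsOpen (openStrip b) :=
  isOpen_Ioo.preimage Complex.continuous_im

lemma openStrip_subset_closedStrip (b : ℝ) : openStrip b ⊆ closedStrip b :=
  fun _ h => ⟨h.1.le, h.2.le⟩

lemma closure_openStrip {b : ℝ} (hb : 0 < b) : closure (openStrip b) = closedStrip b := by
  have : openStrip b = Complex.im ⁻¹' Set.Ioo 0 b := rfl
  rw [this, Complex.closure_preimage_im, closure_Ioo hb.ne]
  rfl

lemma convex_openStrip (b : ℝ) : Convex ℝ (openStrip b) := by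
  have : openStrip b = Complex.imLm ⁻¹' Set.Ioo 0 b := rfl
  rw [this]
  exact (convex_Ioo 0 b).linear_preimage _

lemma ofReal_mem_closedStrip {b : ℝ} (hb : 0 ≤ b) (t : ℝ) : (t : ℂ) ∈ closedStrip b := by
  simp [closedStrip, hb]

lemma I_mul_mem_closedStrip {b : ℝ} (hb : 0 ≤ b) : Complex.I * b ∈ closedStrip b := by
  simp [closedStrip, hb]

/-- A holomorphic function on the open strip that is continuous on the closed strip and vanishes
on the real line vanishes in the lower half of the strip. -/
lemma eq_zero_of_two_mul_im_le {b : ℝ} {f : ℂ → ℂ} (hc : ContinuousOn f (closedStrip b))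
    (hd : DifferentiableOn ℂ f (openStrip b)) (h0 : ∀ t : ℝ, f t = 0) {c : ℂ} (hc0 : 0 < c.im)
    (hcb : 2 * c.im ≤ b) : f c = 0 := by
  set a := c.im
  -- The four functions w ↦ f(c + vw), v = ±1, ±i, are defined on this square. Each side is carried
  -- to the real line by one of the rotations, so their product vanishes on the frontier, and the
  -- maximum principle at w = 0 gives f(c)⁴ = 0.
  let S : Set ℂ := Set.Ioo (-a) a ×ℂ Set.Ioo (-a) a
  have hcl : closure S = Set.Icc (-a) a ×ℂ Set.Icc (-a) a := by
    rw [Complex.closure_reProdIm, closure_Ioo (by linarith)]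
  have hfr : frontier S ⊆ {w | w ∈ closure S ∧ (w.re = -a ∨ w.re = a ∨ w.im = -a ∨ w.im = a)} := by
    intro w hw
    refine ⟨hw.1, ?_⟩
    rw [Complex.frontier_reProdIm, frontier_Ioo (by linarith)] at hw
    rcases hw with hw | hw
    · have : w.im ∈ ({-a, a} : Set ℝ) := hw.2
      simp only [Set.mem_insert_iff, Set.mem_singleton_iff] at this
      tauto
    · have : w.re ∈ ({-a, a} : Set ℝ) := hw.1
      simp only [Set.mem_insert_iff, Set.mem_singleton_iff] at this
      tauto
  have hclw : ∀ w ∈ closure S, (-a ≤ w.re ∧ w.re ≤ a) ∧ (-a ≤ w.im ∧ w.im ≤ a) := by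
    intro w hw
    rw [hcl] at hw
    exact hw
  have hop : ∀ w ∈ S, (-a < w.re ∧ w.re < a) ∧ (-a < w.im ∧ w.im < a) := fun w hw => hw
  have hf : ∀ v : ℂ, (∀ w ∈ closure S, c + v * w ∈ closedStrip b) →
      (∀ w ∈ S, c + v * w ∈ openStrip b) → DiffContOnCl ℂ (fun w => f (c + v * w)) S := by
    intro v h1 h2
    refine ⟨hd.comp (by fun_prop) h2, hc.comp (by fun_prop) h1⟩
  have m1 : ∀ v : ℂ, (v = 1 ∨ v = -1 ∨ v = Complex.I ∨ v = -Complex.I) →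
      ∀ w ∈ closure S, c + v * w ∈ closedStrip b := by
    intro v hv w hw
    have := hclw w hw
    rcases hv with rfl | rfl | rfl | rfl <;>
      simp only [closedStrip, Set.mem_ofPred_eq, Complex.add_im, Complex.mul_im, Complex.one_re,
        Complex.one_im, Complex.neg_re, Complex.neg_im, Complex.I_re, Complex.I_im] <;>
      constructor <;> linarith
  have m2 : ∀ v : ℂ, (v = 1 ∨ v = -1 ∨ v = Complex.I ∨ v = -Complex.I) →
      ∀ w ∈ S, c + v * w ∈ openStrip b := by
    intro v hv w hw
    have := hop w hw
    rcases hv with rfl | rfl | rfl | rfl <;>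
      simp only [openStrip, Set.mem_ofPred_eq, Complex.add_im, Complex.mul_im, Complex.one_re,
        Complex.one_im, Complex.neg_re, Complex.neg_im, Complex.I_re, Complex.I_im] <;>
      constructor <;> linarith
  have hz : ∀ v w : ℂ, (c + v * w).im = 0 → f (c + v * w) = 0 := by
    intro v w h
    have : c + v * w = ((c + v * w).re : ℂ) := Complex.ext (by simp) (by simpa using h)
    rw [this, h0]
  have hprod : DiffContOnCl ℂ (fun w => (f (c + 1 * w) * f (c + (-1) * w)) *
      (f (c + Complex.I * w) * f (c + (-Complex.I) * w))) S := by
    have k := fun v hv => hf v (m1 v hv) (m2 v hv)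
    exact ((k 1 (by simp)).smul (k (-1) (by simp))).smul
      ((k Complex.I (by simp)).smul (k (-Complex.I) (by simp)))
  have hbd : Bornology.IsBounded S :=
    (Metric.isBounded_Ioo (-a) a).reProdIm (Metric.isBounded_Ioo (-a) a)
  have h0S : (0 : ℂ) ∈ closure S := subset_closure ⟨by simp [hc0], by simp [hc0]⟩
  have key := Complex.norm_le_of_forall_mem_frontier_norm_le hbd hprod (C := 0) (fun w hw => by
    have : (f (c + 1 * w) * f (c + (-1) * w)) *
        (f (c + Complex.I * w) * f (c + (-Complex.I) * w)) = 0 := by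
      rcases (hfr hw).2 with h | h | h | h
      · rw [hz Complex.I w (by simp [h, a])]; simp
      · rw [hz (-Complex.I) w (by simp [h, a])]; simp
      · rw [hz 1 w (by simp [h, a])]; simp
      · rw [hz (-1) w (by simp [h, a])]; simp
    rw [this, norm_zero]) h0S
  by_contra h
  have h1 : 0 < ‖f c‖ := norm_pos_iff.2 h
  have h2 : 0 < ‖f c‖ * ‖f c‖ * (‖f c‖ * ‖f c‖) := by positivity
  simp only [mul_zero, add_zero, norm_mul] at key
  linarith

/-- Uniqueness of holomorphic extensions to a strip. -/
lemma eq_zero_on_closedStrip {b : ℝ} (hb : 0 < b) {f : ℂ → ℂ} (hc : ContinuousOn f (closedStrip b))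
    (hd : DifferentiableOn ℂ f (openStrip b)) (h0 : ∀ t : ℝ, f t = 0) {z : ℂ}
    (hz : z ∈ closedStrip b) : f z = 0 := by
  have han : AnalyticOnNhd ℂ f (openStrip b) := hd.analyticOnNhd (isOpen_openStrip b)
  set c : ℂ := Complex.I * (b / 4 : ℝ)
  have hcim : c.im = b / 4 := by simp [c]
  have hcS : c ∈ openStrip b := ⟨by rw [hcim]; positivity, by rw [hcim]; linarith⟩
  have hev : f =ᶠ[𝓝 c] 0 := by
    have : ∀ᶠ w in 𝓝 c, w.im ∈ Set.Ioo 0 (b / 2) :=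
      Complex.continuous_im.continuousAt.eventually_mem
        (Ioo_mem_nhds (by rw [hcim]; positivity) (by rw [hcim]; linarith))
    filter_upwards [this] with w hw
    exact eq_zero_of_two_mul_im_le hc hd h0 hw.1 (by linarith [hw.2])
  have h1 := han.eqOn_zero_of_preconnected_of_eventuallyEq_zero
    (convex_openStrip b).isPreconnected hcS hev
  exact Set.EqOn.of_subset_closure h1 hc continuousOn_const (openStrip_subset_closedStrip b)
    (closure_openStrip hb).ge hz

lemma eqOn_closedStrip {b : ℝ} (hb : 0 < b) {f g : ℂ → ℂ} (hfc : ContinuousOn f (closedStrip b))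
    (hfd : DifferentiableOn ℂ f (openStrip b)) (hgc : ContinuousOn g (closedStrip b))
    (hgd : DifferentiableOn ℂ g (openStrip b)) (h : ∀ t : ℝ, f t = g t) {z : ℂ}
    (hz : z ∈ closedStrip b) : f z = g z :=
  sub_eq_zero.1 (eq_zero_on_closedStrip hb (hfc.sub hgc) (hfd.sub hgd)
    (fun t => sub_eq_zero.2 (h t)) hz)

/-- The reflection z ↦ -z̄ compensates for the antilinearity of distribution vectors: it preserves
the strip, sends t to -t and fixes the imaginary axis. -/
lemma neg_conj_mem_closedStrip {b : ℝ} {z : ℂ} (hz : z ∈ closedStrip b) :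
    -(starRingEnd ℂ z) ∈ closedStrip b := by
  simpa [closedStrip] using hz

lemma neg_conj_mem_openStrip {b : ℝ} {z : ℂ} (hz : z ∈ openStrip b) :
    -(starRingEnd ℂ z) ∈ openStrip b := by
  simpa [openStrip] using hz

lemma continuousOn_conj_neg_conj {b : ℝ} {f : ℂ → ℂ} (hc : ContinuousOn f (closedStrip b)) :
    ContinuousOn (fun z => starRingEnd ℂ (f (-(starRingEnd ℂ z)))) (closedStrip b) :=
  Complex.continuous_conj.comp_continuousOn
    (hc.comp Complex.continuous_conj.neg.continuousOn fun _ hz => neg_conj_mem_closedStrip hz)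

lemma differentiableOn_conj_neg_conj {b : ℝ} {f : ℂ → ℂ}
    (hd : DifferentiableOn ℂ f (openStrip b)) :
    DifferentiableOn ℂ (fun z => starRingEnd ℂ (f (-(starRingEnd ℂ z)))) (openStrip b) := by
  intro z hz
  have h1 : DifferentiableAt ℂ f (-(starRingEnd ℂ z)) :=
    (hd _ (neg_conj_mem_openStrip hz)).differentiableAt
      ((isOpen_openStrip b).mem_nhds (neg_conj_mem_openStrip hz))
  have h2 : DifferentiableAt ℂ (fun w => f (-w)) (starRingEnd ℂ z) :=
    h1.comp (starRingEnd ℂ z) differentiableAt_id.neg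
  have h3 := h2.conj_conj
  rw [Complex.conj_conj] at h3
  exact h3.differentiableWithinAt

/-- A Phragmén–Lindelöf estimate for functions of exponential growth on the strip. -/
lemma norm_le_of_boundary_exp_growth {f : ℂ → ℂ} (hc : ContinuousOn f (closedStrip Real.pi))
    (hd : DifferentiableOn ℂ f (openStrip Real.pi)) {A K M : ℝ} 
    (hA : ∀ z ∈ closedStrip Real.pi, ‖f z‖ ≤ A * Real.exp (K * |z.re|))
    (h0 : ∀ t : ℝ, ‖f t‖ ≤ M * Real.exp (K * |t|))
    (h1 : ∀ t : ℝ, ‖f (t + Complex.I * Real.pi)‖ ≤ M * Real.exp (K * |t|)) {z : ℂ}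
    (hz : z ∈ closedStrip Real.pi) :
    ‖f z‖ ≤ M * Real.exp (Real.pi ^ 2 + K ^ 2 / 4 + z.re ^ 2) := by
  have hM : 0 ≤ M := by simpa using (norm_nonneg _).trans (h0 0)
  have hA0 : 0 ≤ A := by
    simpa using (norm_nonneg _).trans (hA 0 (ofReal_mem_closedStrip Real.pi_pos.le 0))
  -- The factor exp(-w²) beats exponential growth. The constants come from Im(w)² ≤ π² and from
  -- K²/4, the bound for K|x| - x².
  have hnorm : ∀ w : ℂ, ‖Complex.exp (-w ^ 2)‖ = Real.exp (w.im ^ 2 - w.re ^ 2) := by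
    intro w
    rw [Complex.norm_exp]
    congr 1
    simp [sq]
  have hquad : ∀ x : ℝ, K * |x| - x ^ 2 ≤ K ^ 2 / 4 := fun x => by
    nlinarith [sq_nonneg (|x| - K / 2), sq_abs x]
  have hbound : ∀ (w : ℂ) (B : ℝ), 0 ≤ B → w ∈ closedStrip Real.pi →
      ‖f w‖ ≤ B * Real.exp (K * |w.re|) →
      ‖Complex.exp (-w ^ 2) * f w‖ ≤ B * Real.exp (Real.pi ^ 2 + K ^ 2 / 4) := by
    intro w B hB hw h
    rw [norm_mul, hnorm]
    calc _ ≤ Real.exp (w.im ^ 2 - w.re ^ 2) * (B * Real.exp (K * |w.re|)) := by gcongr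
      _ = B * Real.exp (w.im ^ 2 + (K * |w.re| - w.re ^ 2)) := by
        rw [mul_left_comm, ← Real.exp_add]; ring_nf
      _ ≤ _ := by
        gcongr
        · exact hw.1
        · exact hw.2
        · exact hquad _
  have hcl := closure_openStrip Real.pi_pos
  have key : ‖Complex.exp (-z ^ 2) * f z‖ ≤ M * Real.exp (Real.pi ^ 2 + K ^ 2 / 4) := by
    -- The corrected function is bounded, so both growth parameters can be 0.
    refine PhragmenLindelof.horizontal_strip (a := 0) (b := Real.pi)
      (f := fun w => Complex.exp (-w ^ 2) * f w) ⟨?_, ?_⟩ ⟨0, by simp, 0, ?_⟩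
      ?_ ?_ hz.1 hz.2
    · exact DifferentiableOn.mul (by fun_prop) hd
    · have : closure (Complex.im ⁻¹' Set.Ioo 0 Real.pi) = closedStrip Real.pi := hcl
      rw [this]
      exact ContinuousOn.mul (by fun_prop) hc
    · refine Asymptotics.IsBigO.of_bound (A * Real.exp (Real.pi ^ 2 + K ^ 2 / 4)) ?_
      rw [eventually_inf_principal]
      refine Eventually.of_forall fun w hw => ?_
      have hw' : w ∈ closedStrip Real.pi := openStrip_subset_closedStrip _ hw
      simpa using hbound w A hA0 hw' (hA w hw')
    · intro w hw
      have e : w = ((w.re : ℝ) : ℂ) := Complex.ext (by simp) (by simpa using hw)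
      refine hbound w M hM ⟨hw.ge, hw.le.trans Real.pi_pos.le⟩ ?_
      have := h0 w.re
      rwa [← e] at this
    · intro w hw
      have e : w = (w.re : ℂ) + Complex.I * Real.pi := Complex.ext (by simp) (by simpa using hw)
      refine hbound w M hM ⟨Real.pi_pos.le.trans hw.ge, hw.le⟩ ?_
      have := h1 w.re
      rwa [← e] at this
  rw [norm_mul, hnorm] at key
  have h2 : ‖f z‖ = Real.exp (z.re ^ 2 - z.im ^ 2) *
      (Real.exp (z.im ^ 2 - z.re ^ 2) * ‖f z‖) := by
    rw [← mul_assoc, ← Real.exp_add]; simp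
  rw [h2]
  calc _ ≤ Real.exp (z.re ^ 2) * (M * Real.exp (Real.pi ^ 2 + K ^ 2 / 4)) := by
        gcongr
        linarith [sq_nonneg z.im]
    _ = _ := by rw [mul_left_comm, ← Real.exp_add]; ring_nf

end StripAnalysis

/-! ### Gaussian averages of functions of exponential growth -/

section Gauss

/-- The Gaussian kernel. -/
def gaussKer (z : ℂ) : ℂ := ((Real.sqrt Real.pi)⁻¹ : ℝ) * Complex.exp (-z ^ 2)

lemma continuous_gaussKer : Continuous gaussKer := by unfold gaussKer; fun_prop

lemma hasDerivAt_gaussKer (z : ℂ) : HasDerivAt gaussKer (-(2 * z) * gaussKer z) z := by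
  unfold gaussKer
  have h := ((((hasDerivAt_id z).pow 2).neg).cexp).const_mul (((Real.sqrt Real.pi)⁻¹ : ℝ) : ℂ)
  refine h.congr_deriv ?_
  change _ * (Complex.exp (-z ^ 2) * _) = _
  simp only [id_eq, Nat.cast_ofNat, Nat.add_one_sub_one, pow_one, mul_one]
  ring

lemma norm_gaussKer (s : ℝ) (w : ℂ) : ‖gaussKer (s - w)‖ =
    (Real.sqrt Real.pi)⁻¹ * Real.exp (w.im ^ 2) * Real.exp (-(s - w.re) ^ 2) := by
  rw [gaussKer, norm_mul, Complex.norm_real, Complex.norm_exp, mul_assoc, ← Real.exp_add,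
    Real.norm_of_nonneg (by positivity)]
  congr 2
  simp [sq]
  ring

lemma conj_gaussKer_ofReal (s : ℝ) : starRingEnd ℂ (gaussKer s) = gaussKer s := by
  have h : gaussKer s = (((Real.sqrt Real.pi)⁻¹ * Real.exp (-s ^ 2) : ℝ) : ℂ) := by
    simp [gaussKer]
  rw [h, Complex.conj_ofReal]

/-- Half of the Gaussian absorbs the exponential: |s| ≤ |s - a| + |a| and Kr ≤ K²/2 + r²/2. -/
lemma exp_neg_sq_mul_exp_le {K : ℝ} (hK : 0 ≤ K) (s a : ℝ) :
    Real.exp (-(s - a) ^ 2) * Real.exp (K * |s|) ≤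
      Real.exp (K ^ 2 / 2) * Real.exp (K * |a|) * Real.exp (-(1 / 2) * (s - a) ^ 2) := by
  rw [← Real.exp_add, ← Real.exp_add, ← Real.exp_add]
  refine Real.exp_le_exp.2 ?_
  have h1 : |s| ≤ |s - a| + |a| := by simpa using abs_add_le (s - a) a
  nlinarith [sq_nonneg (|s - a| - K), sq_abs (s - a), mul_le_mul_of_nonneg_left h1 hK]

lemma integrable_exp_half_sq (a : ℝ) :
    Integrable fun s : ℝ => Real.exp (-(1 / 2) * (s - a) ^ 2) :=
  (integrable_exp_neg_mul_sq (b := 1 / 2) (by norm_num)).comp_sub_right a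

lemma integrable_exp_neg_sq_mul_exp {K : ℝ} (hK : 0 ≤ K) (a : ℝ) :
    Integrable fun s : ℝ => Real.exp (-(s - a) ^ 2) * Real.exp (K * |s|) := by
  refine ((integrable_exp_half_sq a).const_mul
    (Real.exp (K ^ 2 / 2) * Real.exp (K * |a|))).mono' (by fun_prop) ?_
  refine Eventually.of_forall fun s => ?_
  rw [Real.norm_of_nonneg (by positivity)]
  exact exp_neg_sq_mul_exp_le hK s a

variable {B : Type*} [NormedAddCommGroup B] [NormedSpace ℂ B]

lemma norm_gaussKer_smul_le {g : ℝ → B} {C K : ℝ} (hg : ∀ s, ‖g s‖ ≤ C * Real.exp (K * |s|))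
    (w : ℂ) (s : ℝ) : ‖gaussKer (s - w) • g s‖ ≤ (Real.sqrt Real.pi)⁻¹ * Real.exp (w.im ^ 2) * C *
      (Real.exp (-(s - w.re) ^ 2) * Real.exp (K * |s|)) := by
  rw [norm_smul, norm_gaussKer]
  calc _ ≤ (Real.sqrt Real.pi)⁻¹ * Real.exp (w.im ^ 2) * Real.exp (-(s - w.re) ^ 2) *
        (C * Real.exp (K * |s|)) := by gcongr; exact hg s
    _ = _ := by ring

lemma integrable_gaussKer_smul {g : ℝ → B} (hgc : Continuous g) {C K : ℝ} (hK : 0 ≤ K)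
    (hg : ∀ s, ‖g s‖ ≤ C * Real.exp (K * |s|)) (w : ℂ) :
    Integrable fun s : ℝ => gaussKer (s - w) • g s := by
  refine ((integrable_exp_neg_sq_mul_exp hK w.re).const_mul
    ((Real.sqrt Real.pi)⁻¹ * Real.exp (w.im ^ 2) * C)).mono' ?_
    (Eventually.of_forall fun s => norm_gaussKer_smul_le hg w s)
  exact ((continuous_gaussKer.comp (by fun_prop)).smul hgc).aestronglyMeasurable

/-- The constant in the growth estimate for Gaussian integrals. -/
def gaussBound (K y : ℝ) : ℝ := (Real.sqrt Real.pi)⁻¹ * Real.exp (y ^ 2) *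
  (Real.exp (K ^ 2 / 2) * ∫ s : ℝ, Real.exp (-(1 / 2) * s ^ 2))

lemma gaussBound_nonneg (K y : ℝ) : 0 ≤ gaussBound K y := by
  unfold gaussBound
  have : 0 ≤ ∫ s : ℝ, Real.exp (-(1 / 2) * s ^ 2) := integral_nonneg fun s => by positivity
  positivity

lemma gaussBound_le {K y b : ℝ} (hy : |y| ≤ b) : gaussBound K y ≤ gaussBound K b := by
  unfold gaussBound
  have : 0 ≤ ∫ s : ℝ, Real.exp (-(1 / 2) * s ^ 2) := integral_nonneg fun s => by positivity
  refine mul_le_mul_of_nonneg_right (mul_le_mul_of_nonneg_left (Real.exp_le_exp.2 ?_)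
    (by positivity)) (by positivity)
  exact sq_le_sq.2 (hy.trans (le_abs_self b))

lemma norm_integral_gaussKer_smul_le {g : ℝ → B} {C K : ℝ} (hC : 0 ≤ C) (hK : 0 ≤ K)
    (hg : ∀ s, ‖g s‖ ≤ C * Real.exp (K * |s|)) (w : ℂ) :
    ‖∫ s : ℝ, gaussKer (s - w) • g s‖ ≤ gaussBound K w.im * C * Real.exp (K * |w.re|) := by
  have h1 := norm_integral_le_of_norm_le (f := fun s : ℝ => gaussKer (s - w) • g s)
    (((integrable_exp_half_sq w.re).const_mul
      (Real.exp (K ^ 2 / 2) * Real.exp (K * |w.re|))).const_mul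
      ((Real.sqrt Real.pi)⁻¹ * Real.exp (w.im ^ 2) * C))
    (Eventually.of_forall fun s => (norm_gaussKer_smul_le hg w s).trans
      (mul_le_mul_of_nonneg_left (exp_neg_sq_mul_exp_le hK s w.re) (by positivity)))
  refine h1.trans (le_of_eq ?_)
  rw [integral_const_mul, integral_const_mul,
    integral_sub_right_eq_self (fun s : ℝ => Real.exp (-(1 / 2) * s ^ 2)) w.re, gaussBound]
  ring

/-- Gaussian integrals of functions of exponential growth are entire. -/
lemma differentiable_integral_gaussKer_smul [CompleteSpace B] {g : ℝ → B} (hgc : Continuous g)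
    {C K : ℝ} (hK : 0 ≤ K) (hg : ∀ s, ‖g s‖ ≤ C * Real.exp (K * |s|)) :
    Differentiable ℂ fun w : ℂ => ∫ s : ℝ, gaussKer (s - w) • g s := by
  intro w₀
  have hC : 0 ≤ C := by simpa using (norm_nonneg _).trans (hg 0)
  set R := ‖w₀‖ + 1
  have hR : 0 < R := by positivity
  -- A bound uniform on the ball: the linear factor is at most 2 exp(|s| + R), and shifting the
  -- Gaussian by Re w costs at most exp(2R|s|).
  have hker : ∀ s : ℝ, ∀ w ∈ Metric.ball w₀ 1,
      ‖(2 * (s - w)) * gaussKer (s - w)‖ ≤ (Real.sqrt Real.pi)⁻¹ * Real.exp (R ^ 2) *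
        (2 * Real.exp R * (Real.exp (-(s - 0) ^ 2) * Real.exp ((1 + 2 * R) * |s|))) := by
    intro s w hw
    have hw' : ‖w‖ ≤ R := by
      have h1 : ‖w - w₀‖ < 1 := by simpa [dist_eq_norm] using hw
      have h2 : ‖w‖ ≤ ‖w - w₀‖ + ‖w₀‖ := by simpa using norm_add_le (w - w₀) w₀
      linarith
    have hre : |w.re| ≤ R := (Complex.abs_re_le_norm w).trans hw'
    have him : w.im ^ 2 ≤ R ^ 2 :=
      sq_le_sq.2 (((Complex.abs_im_le_norm w).trans hw').trans (le_abs_self R))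
    rw [norm_mul, norm_mul, norm_gaussKer, Complex.norm_ofNat]
    have h3 : ‖(s : ℂ) - w‖ ≤ Real.exp (|s| + R) := by
      refine (norm_sub_le _ _).trans ?_
      rw [Complex.norm_real]
      have := Real.add_one_le_exp (|s| + R)
      have h4 : ‖s‖ = |s| := rfl
      linarith
    have h5 : Real.exp (-(s - w.re) ^ 2) ≤ Real.exp (-(s - 0) ^ 2 + 2 * R * |s|) := by
      refine Real.exp_le_exp.2 ?_
      have h6 : s * w.re ≤ |s| * R := (le_abs_self _).trans (by rw [abs_mul]; gcongr)
      nlinarith [sq_nonneg w.re]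
    calc _ ≤ 2 * Real.exp (|s| + R) * ((Real.sqrt Real.pi)⁻¹ * Real.exp (R ^ 2) *
          Real.exp (-(s - 0) ^ 2 + 2 * R * |s|)) := by gcongr
      _ = _ := by
        rw [add_mul 1 (2 * R), one_mul, Real.exp_add |s| R, Real.exp_add |s| (2 * R * |s|),
          Real.exp_add (-(s - 0) ^ 2)]
        ring
  have key := hasDerivAt_integral_of_dominated_loc_of_deriv_le (μ := volume)
    (F := fun (w : ℂ) (s : ℝ) => gaussKer (s - w) • g s)
    (F' := fun (w : ℂ) (s : ℝ) => ((2 * (s - w)) * gaussKer (s - w)) • g s) (x₀ := w₀)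
    (bound := fun s => (Real.sqrt Real.pi)⁻¹ * Real.exp (R ^ 2) * (2 * Real.exp R) * C *
      (Real.exp (-(s - 0) ^ 2) * Real.exp ((1 + 2 * R + K) * |s|)))
    (Metric.ball_mem_nhds w₀ one_pos)
    (Eventually.of_forall fun w => (integrable_gaussKer_smul hgc hK hg w).aestronglyMeasurable)
    (integrable_gaussKer_smul hgc hK hg w₀)
    ((Continuous.smul (by
      have : Continuous fun s : ℝ => gaussKer (s - w₀) := continuous_gaussKer.comp (by fun_prop)
      fun_prop) hgc).aestronglyMeasurable)
    (Eventually.of_forall fun s w hw => ?_)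
    ((integrable_exp_neg_sq_mul_exp (by positivity) 0).const_mul _)
    (Eventually.of_forall fun s w hw => ?_)
  · exact key.2.differentiableAt
  · rw [norm_smul]
    calc _ ≤ (Real.sqrt Real.pi)⁻¹ * Real.exp (R ^ 2) *
        (2 * Real.exp R * (Real.exp (-(s - 0) ^ 2) * Real.exp ((1 + 2 * R) * |s|))) *
          (C * Real.exp (K * |s|)) :=
          mul_le_mul (hker s w hw) (hg s) (norm_nonneg _) (by positivity)
      _ = _ := by rw [add_mul (1 + 2 * R) K, Real.exp_add ((1 + 2 * R) * |s|)]; ring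
  · have h1 : HasDerivAt (fun w : ℂ => (s : ℂ) - w) (-1) w := by
      simpa using (hasDerivAt_id w).const_sub (s : ℂ)
    have h2 := ((hasDerivAt_gaussKer (s - w)).comp w h1).smul_const (g s)
    refine h2.congr_deriv ?_
    congr 1
    ring

lemma integral_gaussKer : ∫ s : ℝ, gaussKer (s - 0) = 1 := by
  have h : ∀ s : ℝ, gaussKer (s - 0) =
      (((Real.sqrt Real.pi)⁻¹ * Real.exp (-1 * s ^ 2) : ℝ) : ℂ) := fun s => by
    simp [gaussKer]
  simp only [h]
  rw [integral_complex_ofReal, integral_const_mul, integral_gaussian, div_one,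
    inv_mul_cancel₀ (by positivity), Complex.ofReal_one]

/-- Gaussian regularizations converge. -/
lemma tendsto_integral_gaussKer_smul [CompleteSpace B] {g : ℝ → B} (hgc : Continuous g)
    {C K : ℝ} (hK : 0 ≤ K) (hg : ∀ s, ‖g s‖ ≤ C * Real.exp (K * |s|)) {ε : ℕ → ℝ}
    (hε : ∀ n, |ε n| ≤ 1) (hε0 : Tendsto ε atTop (𝓝 0)) :
    Tendsto (fun n => ∫ s : ℝ, gaussKer (s - 0) • g (ε n * s)) atTop (𝓝 (g 0)) := by
  have hC : 0 ≤ C := by simpa using (norm_nonneg _).trans (hg 0)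
  have h1 : g 0 = ∫ s : ℝ, gaussKer (s - 0) • g 0 := by
    rw [integral_smul_const, integral_gaussKer, one_smul]
  rw [h1]
  refine tendsto_integral_of_dominated_convergence
    (fun s : ℝ => (Real.sqrt Real.pi)⁻¹ * Real.exp ((0 : ℂ).im ^ 2) * C *
      (Real.exp (-(s - (0 : ℂ).re) ^ 2) * Real.exp (K * |s|)))
    (fun n => ?_) ((integrable_exp_neg_sq_mul_exp hK _).const_mul _)
    (fun n => Eventually.of_forall fun s => ?_) (Eventually.of_forall fun s => ?_)
  · exact ((continuous_gaussKer.comp (by fun_prop)).smul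
      (hgc.comp (by fun_prop))).aestronglyMeasurable
  · refine norm_gaussKer_smul_le (g := fun s => g (ε n * s)) (fun s => (hg _).trans ?_) 0 s
    have : |ε n * s| ≤ |s| := by
      rw [abs_mul]; exact mul_le_of_le_one_left (abs_nonneg s) (hε n)
    gcongr
  · refine Tendsto.const_smul ?_ _
    have : Tendsto (fun n => ε n * s) atTop (𝓝 0) := by simpa using hε0.mul_const s
    exact (hgc.tendsto 0).comp this

end Gauss

/-! ### Convergence on the strip from convergence on its boundary -/

section StripLimit

/-- Limits of functions on the strip whose boundary values converge. -/
lemma exists_strip_limit {Φ : ℕ → ℂ → ℂ} (hd : ∀ n, Differentiable ℂ (Φ n)) {K : ℝ}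
    (hgrowth : ∀ n, ∃ A, ∀ z ∈ closedStrip Real.pi, ‖Φ n z‖ ≤ A * Real.exp (K * |z.re|))
    {e : ℕ → ℝ} (he : Tendsto e atTop (𝓝 0))
    (h0 : ∀ n m (t : ℝ), ‖Φ n t - Φ m t‖ ≤ (e n + e m) * Real.exp (K * |t|))
    (h1 : ∀ n m (t : ℝ), ‖Φ n (t + Complex.I * Real.pi) - Φ m (t + Complex.I * Real.pi)‖ ≤
      (e n + e m) * Real.exp (K * |t|)) :
    ∃ Ψ : ℂ → ℂ, ContinuousOn Ψ (closedStrip Real.pi) ∧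
      DifferentiableOn ℂ Ψ (openStrip Real.pi) ∧
      ∀ z ∈ closedStrip Real.pi, Tendsto (fun n => Φ n z) atTop (𝓝 (Ψ z)) := by
  set c : ℂ → ℝ := fun z => Real.exp (Real.pi ^ 2 + K ^ 2 / 4 + z.re ^ 2)
  have hcc : Continuous c := by fun_prop
  -- The growth constants A may depend on n, since Phragmén–Lindelöf retains only the boundary
  -- constant.
  have hbd : ∀ n m, ∀ z ∈ closedStrip Real.pi, ‖Φ n z - Φ m z‖ ≤ (e n + e m) * c z := by
    intro n m z hz
    obtain ⟨A, hA⟩ := hgrowth n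
    obtain ⟨A', hA'⟩ := hgrowth m
    refine norm_le_of_boundary_exp_growth (f := fun w => Φ n w - Φ m w) (A := A + A')
      ((hd n).sub (hd m)).continuous.continuousOn ((hd n).sub (hd m)).differentiableOn
      (fun w hw => ?_) (h0 n m) (h1 n m) hz
    rw [add_mul]
    exact (norm_sub_le _ _).trans (add_le_add (hA w hw) (hA' w hw))
  have hcau : ∀ z ∈ closedStrip Real.pi, ∃ l, Tendsto (fun n => Φ n z) atTop (𝓝 l) := by
    intro z hz
    refine cauchySeq_tendsto_of_complete (Metric.cauchySeq_iff'.2 fun ε hε => ?_)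
    have h2 : ∀ᶠ n in atTop, |e n| < ε / (2 * c z) := by
      have := he.abs
      rw [abs_zero] at this
      exact this.eventually_lt_const (by positivity)
    obtain ⟨N, hN⟩ := eventually_atTop.1 h2
    refine ⟨N, fun n hn => ?_⟩
    rw [dist_eq_norm]
    refine (hbd n N z hz).trans_lt ?_
    have h3 : e n + e N < ε / c z := by
      have h4 := (le_abs_self _).trans_lt (hN n hn)
      have h5 := (le_abs_self _).trans_lt (hN N le_rfl)
      have h6 : ε / c z = ε / (2 * c z) + ε / (2 * c z) := by
        have : c z ≠ 0 := (Real.exp_pos _).ne'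
        field_simp; norm_num
      linarith
    exact (lt_div_iff₀ (Real.exp_pos _)).1 h3
  choose! Ψ hΨ using hcau
  have hlim : ∀ n, ∀ z ∈ closedStrip Real.pi, ‖Φ n z - Ψ z‖ ≤ e n * c z := by
    intro n z hz
    have h2 : Tendsto (fun m => (e n + e m) * c z) atTop (𝓝 ((e n + 0) * c z)) :=
      (tendsto_const_nhds.add he).mul_const _
    rw [add_zero] at h2
    exact le_of_tendsto_of_tendsto' (tendsto_const_nhds.sub (hΨ z hz)).norm h2
      fun m => hbd n m z hz
  have hloc : TendstoLocallyUniformlyOn Φ Ψ atTop (closedStrip Real.pi) := by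
    rw [Metric.tendstoLocallyUniformlyOn_iff]
    intro ε hε z hz
    have h2 : ∀ᶠ w in 𝓝 z, c w < c z + 1 :=
      hcc.continuousAt.eventually_lt_const (by linarith)
    refine ⟨{w | c w < c z + 1} ∩ closedStrip Real.pi,
      inter_mem (mem_nhdsWithin_of_mem_nhds h2) self_mem_nhdsWithin, ?_⟩
    have hcz : 0 < c z + 1 := by positivity
    have h3 : Tendsto (fun n => |e n| * (c z + 1)) atTop (𝓝 0) := by
      simpa using he.abs.mul_const (c z + 1)
    filter_upwards [h3.eventually_lt_const hε] with n hn w hw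
    rw [dist_comm, dist_eq_norm]
    refine (hlim n w hw.2).trans_lt (lt_of_le_of_lt ?_ hn)
    exact mul_le_mul (le_abs_self _) (le_of_lt hw.1) (Real.exp_pos _).le (abs_nonneg _)
  exact ⟨Ψ, hloc.continuousOn (Frequently.of_forall fun n => (hd n).continuous.continuousOn),
    (hloc.mono (openStrip_subset_closedStrip _)).differentiableOn
      (Eventually.of_forall fun n => (hd n).differentiableOn) (isOpen_openStrip _), hΨ⟩

end StripLimit

/-! ### Uniqueness of orbit extensions -/

section Extension

variable {Y : Type*} [AddCommGroup Y] [Module ℂ Y] [TopologicalSpace Y]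

/-- Any extension computes the operator: continuous functionals separate points, and scalar
extensions are unique. -/
lemma IsOrbitExtension.extOp_eq {V : ℝ → Y → Y} {b : ℝ} (hb : 0 < b)
    (hsep : ∀ y y' : Y, (∀ α : Y →L[ℂ] ℂ, α y = α y') → y = y') {y : Y} {F : ℂ → Y}
    (hF : IsOrbitExtension V b y F) : extOp V b y = F (Complex.I * b) := by
  have hex : ∃ F : ℂ → Y, IsOrbitExtension V b y F := ⟨F, hF⟩
  rw [extOp, dif_pos hex]
  have hF' := hex.choose_spec
  refine hsep _ _ fun α => eqOn_closedStrip hb (α.continuous.comp_continuousOn hF'.continuousOn)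
    (hF'.weaklyHolomorphic α) (α.continuous.comp_continuousOn hF.continuousOn)
    (hF.weaklyHolomorphic α) (fun t => ?_) (I_mul_mem_closedStrip hb.le)
  simp only [Function.comp_apply, hF.extends_orbit, hF'.extends_orbit]

lemma IsOrbitExtension.smul [ContinuousSMul ℂ Y] {V : ℝ → Y → Y} {b : ℝ} {y : Y} {F : ℂ → Y}
    (hF : IsOrbitExtension V b y F) (c : ℂ) (hV : ∀ t, V t (c • y) = c • V t y) :
    IsOrbitExtension V b (c • y) (fun z => c • F z) where
  continuousOn := hF.continuousOn.const_smul c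
  weaklyHolomorphic α := by
    simp only [map_smul]
    exact (hF.weaklyHolomorphic α).const_smul c
  extends_orbit t := by rw [hF.extends_orbit, hV]

end Extension

/-! ### Gaussian regularization of smooth vectors -/

section GaussOp

variable {E : Type*} [NormedAddCommGroup E] [NormedSpace ℝ E] [FiniteDimensional ℝ E]
  {G : Type*} [TopologicalSpace G] [T2Space G] [ChartedSpace E G] [Group G]
  [LieGroup 𝓘(ℝ, E) ∞ G]
  {H : Type*} [NormedAddCommGroup H] [InnerProductSpace ℂ H]
  {U : G →* (H ≃ₗᵢ[ℂ] H)} (h : GroupLieAlgebra 𝓘(ℝ, E) G)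

lemma exists_norm_map_smoothFlow_le {B : Type*} [NormedAddCommGroup B] [NormedSpace ℂ B]
    (β : SmoothVec E U →L[ℂ] B) : ∃ (n : ℕ) (C K : ℝ), 0 ≤ C ∧ 0 ≤ K ∧
      ∀ (t : ℝ) (ξ : SmoothVec E U),
        ‖β (smoothFlow U h t ξ)‖ ≤ C * sobolev U n ξ * Real.exp (K * |t|) := by
  obtain ⟨n, C, hC, hβ⟩ := exists_le_sobolev ((normSeminorm ℂ B).comp β.toLinearMap)
    (continuous_norm.comp β.continuous)
  obtain ⟨C', K, hC', hK, hf⟩ := exists_sobolev_smoothFlow_le (U := U) h n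
  refine ⟨n, C * C', K, by positivity, hK, fun t ξ => (hβ _).trans ?_⟩
  calc _ ≤ C * (C' * Real.exp (K * |t|) * sobolev U n ξ) :=
        mul_le_mul_of_nonneg_left (hf t ξ) hC
    _ = _ := by ring

omit [FiniteDimensional ℝ E] [T2Space G] in
lemma smoothVec_eq_of_dual {ξ ζ : SmoothVec E U}
    (hsep : ∀ α : SmoothVec E U →L[ℂ] ℂ, α ξ = α ζ) : ξ = ζ :=
  SmoothVec.ext <| ext_inner_left ℂ fun v => hsep ((innerSL ℂ v).comp (wordCLM U []))

omit [FiniteDimensional ℝ E] [T2Space G] in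
lemma smoothFlow_smul (t : ℝ) (c : ℂ) (ξ : SmoothVec E U) :
    smoothFlow U h t (c • ξ) = c • smoothFlow U h t ξ :=
  map_smul (smoothAct U (lieExp (t • h))) c ξ

/-- The integrand of the Gaussian regularization. -/
def gaussIntegrand (ε : ℝ) (w : ℂ) (ξ : SmoothVec E U) (s : ℝ) : SmoothVec E U :=
  gaussKer (s - w) • smoothFlow U h (ε * s) ξ

lemma continuous_gaussIntegrand (hU : ∀ ξ : H, Continuous fun g => U g ξ) (ε : ℝ) (w : ℂ)
    (ξ : SmoothVec E U) : Continuous (gaussIntegrand h ε w ξ) :=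
  (continuous_gaussKer.comp (by fun_prop)).smul
    ((continuous_smoothFlow h hU ξ).comp (by fun_prop))

lemma integrable_sobolev_gaussIntegrand (hU : ∀ ξ : H, Continuous fun g => U g ξ) (ε : ℝ) (w : ℂ)
    (ξ : SmoothVec E U) (n : ℕ) : Integrable fun s => sobolev U n (gaussIntegrand h ε w ξ s) := by
  obtain ⟨C, K, hC, hK, hf⟩ := exists_sobolev_smoothFlow_le (U := U) h n
  have h1 := integrable_gaussKer_smul (B := ℂ)
    (g := fun s => (sobolev U n (smoothFlow U h (ε * s) ξ) : ℂ))
    (Complex.continuous_ofReal.comp ((continuous_sobolev n).comp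
      ((continuous_smoothFlow h hU ξ).comp (by fun_prop))))
    (C := C * sobolev U n ξ) (K := K * |ε|) (by positivity) (fun s => ?_) w
  · refine h1.norm.congr (Eventually.of_forall fun s => ?_)
    change ‖gaussKer (s - w) • (sobolev U n (smoothFlow U h (ε * s) ξ) : ℂ)‖ =
      sobolev U n (gaussKer (s - w) • smoothFlow U h (ε * s) ξ)
    rw [map_smul_eq_mul, norm_smul, Complex.norm_real,
      Real.norm_of_nonneg (apply_nonneg _ _)]
  · rw [Complex.norm_real, Real.norm_of_nonneg (apply_nonneg _ _)]
    refine (hf _ ξ).trans (le_of_eq ?_)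
    rw [abs_mul]; ring_nf

variable [CompleteSpace H]

/-- The Gaussian regularization `ξ ↦ ∫ κ(s - w) U^∞(exp(ε s h)) ξ ds`. -/
def gaussOp (ε : ℝ) (w : ℂ) (ξ : SmoothVec E U) : SmoothVec E U :=
  smoothIntegral (gaussIntegrand h ε w ξ)

variable (hU : ∀ ξ : H, Continuous fun g => U g ξ)
include hU

lemma map_gaussOp {B : Type*} [NormedAddCommGroup B] [NormedSpace ℂ B] [CompleteSpace B]
    (β : SmoothVec E U →L[ℂ] B) (ε : ℝ) (w : ℂ) (ξ : SmoothVec E U) :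
    β (gaussOp h ε w ξ) = ∫ s : ℝ, gaussKer (s - w) • β (smoothFlow U h (ε * s) ξ) := by
  rw [gaussOp, map_smoothIntegral (continuous_gaussIntegrand h hU ε w ξ)
    (integrable_sobolev_gaussIntegrand h hU ε w ξ)]
  simp only [gaussIntegrand, map_smul]

lemma val_gaussOp (ε : ℝ) (w : ℂ) (ξ : SmoothVec E U) :
    (gaussOp h ε w ξ).val = ∫ s : ℝ, gaussKer (s - w) • (smoothFlow U h (ε * s) ξ).val :=
  map_gaussOp h hU (wordCLM U []) ε w ξ

lemma exists_norm_map_gaussOp_le {B : Type*} [NormedAddCommGroup B] [NormedSpace ℂ B]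
    [CompleteSpace B] (β : SmoothVec E U →L[ℂ] B) : ∃ (n : ℕ) (C K : ℝ), 0 ≤ C ∧ 0 ≤ K ∧
      ∀ (ε : ℝ) (w : ℂ) (ξ : SmoothVec E U), ‖β (gaussOp h ε w ξ)‖ ≤
        gaussBound (K * |ε|) w.im * (C * sobolev U n ξ) * Real.exp (K * |ε| * |w.re|) := by
  obtain ⟨n, C, K, hC, hK, hβ⟩ := exists_norm_map_smoothFlow_le (U := U) h β
  refine ⟨n, C, K, hC, hK, fun ε w ξ => ?_⟩
  rw [map_gaussOp h hU]
  refine norm_integral_gaussKer_smul_le (mul_nonneg hC (apply_nonneg _ _)) (by positivity)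
    (fun s => (hβ _ ξ).trans (le_of_eq ?_)) w
  rw [abs_mul, mul_assoc K]

lemma gaussOp_add (ε : ℝ) (w : ℂ) (ξ ζ : SmoothVec E U) :
    gaussOp h ε w (ξ + ζ) = gaussOp h ε w ξ + gaussOp h ε w ζ := by
  have hi := fun ξ : SmoothVec E U => integrable_comp_of_sobolev
    (continuous_gaussIntegrand h hU ε w ξ) (integrable_sobolev_gaussIntegrand h hU ε w ξ)
    (wordCLM U [])
  apply SmoothVec.ext
  rw [SmoothVec.val_add, val_gaussOp h hU, val_gaussOp h hU, val_gaussOp h hU]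
  refine Eq.trans (integral_congr_ae (Eventually.of_forall fun s => ?_))
    (integral_add (hi ξ) (hi ζ))
  change gaussKer (s - w) • (smoothAct U (lieExp ((ε * s) • h)) (ξ + ζ)).val = _
  rw [map_add, SmoothVec.val_add, smul_add]
  rfl

lemma gaussOp_smul (ε : ℝ) (w c : ℂ) (ξ : SmoothVec E U) :
    gaussOp h ε w (c • ξ) = c • gaussOp h ε w ξ := by
  apply SmoothVec.ext
  rw [SmoothVec.val_smul, val_gaussOp h hU, val_gaussOp h hU, ← integral_smul]
  refine integral_congr_ae (Eventually.of_forall fun s => ?_)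
  simp only [smoothFlow_smul, SmoothVec.val_smul]
  rw [smul_comm]

/-- The Gaussian regularization as a continuous linear map. -/
def gaussCLM (ε : ℝ) (w : ℂ) : SmoothVec E U →L[ℂ] SmoothVec E U where
  toFun := gaussOp h ε w
  map_add' := gaussOp_add h hU ε w
  map_smul' := gaussOp_smul h hU ε w
  cont := by
    refine WithSeminorms.continuous_of_isBounded withSeminorms_sobolev withSeminorms_wordSeminorm
      ({ toFun := gaussOp h ε w, map_add' := gaussOp_add h hU ε w,
         map_smul' := gaussOp_smul h hU ε w } : SmoothVec E U →ₗ[ℂ] SmoothVec E U)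
      (Seminorm.IsBounded.of_real fun L => ?_)
    obtain ⟨n, C, K, hC, hK, hβ⟩ := exists_norm_map_gaussOp_le h hU (wordCLM U L)
    refine ⟨{n}, gaussBound (K * |ε|) w.im * C * Real.exp (K * |ε| * |w.re|), fun ξ => ?_⟩
    refine (hβ ε w ξ).trans (le_of_eq ?_)
    rw [Finset.sup_singleton]
    ring

lemma smoothFlow_gaussOp (ε t : ℝ) (w : ℂ) (ξ : SmoothVec E U) :
    smoothFlow U h t (gaussOp h ε w ξ) = gaussOp h ε w (smoothFlow U h t ξ) := by
  apply SmoothVec.ext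
  rw [val_gaussOp h hU]
  refine (map_gaussOp h hU ((wordCLM U []).comp (smoothAct U (lieExp (t • h)))) ε w ξ).trans ?_
  refine integral_congr_ae (Eventually.of_forall fun s => ?_)
  change gaussKer (s - w) • (smoothFlow U h t (smoothFlow U h (ε * s) ξ)).val = _
  simp only [← smoothFlow_add, add_comm]

/-- Substitute s + t/ε for s. With w = 0 this identifies z ↦ `gaussOp h ε (z / ε) ξ` with the orbit
on the real line; with w = iπ it treats the upper boundary. -/
lemma gaussOp_add_ofReal {ε : ℝ} (hε : ε ≠ 0) (t : ℝ) (w : ℂ) (ξ : SmoothVec E U) :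
    gaussOp h ε ((t + w) / ε) ξ = gaussOp h ε (w / ε) (smoothFlow U h t ξ) := by
  apply SmoothVec.ext
  rw [val_gaussOp h hU, val_gaussOp h hU, ← integral_add_right_eq_self _ (t / ε)]
  refine integral_congr_ae (Eventually.of_forall fun s => ?_)
  simp only
  rw [← smoothFlow_add]
  have e1 : ((s + t / ε : ℝ) : ℂ) - (t + w) / ε = s - w / ε := by push_cast; ring
  have e2 : ε * (s + t / ε) = ε * s + t := by field_simp
  rw [e1, e2]

lemma differentiable_map_gaussOp {B : Type*} [NormedAddCommGroup B] [NormedSpace ℂ B]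
    [CompleteSpace B] (β : SmoothVec E U →L[ℂ] B) (ε : ℝ) (ξ : SmoothVec E U) :
    Differentiable ℂ fun z : ℂ => β (gaussOp h ε (z / ε) ξ) := by
  obtain ⟨n, C, K, hC, hK, hβ⟩ := exists_norm_map_smoothFlow_le (U := U) h β
  simp only [map_gaussOp h hU]
  have h1 := differentiable_integral_gaussKer_smul (g := fun s => β (smoothFlow U h (ε * s) ξ))
    (C := C * sobolev U n ξ) (K := K * |ε|)
    (β.continuous.comp ((continuous_smoothFlow h hU ξ).comp (by fun_prop))) (by positivity)
    fun s => (hβ _ ξ).trans (le_of_eq (by rw [abs_mul, mul_assoc K]))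
  exact h1.comp (differentiable_id.div_const (ε : ℂ))

/-- The kernel carries the z-dependence, so every continuous functional and every word is entire in
z; continuity of the words is continuity in H^∞. -/
lemma isOrbitExtension_gaussOp {ε : ℝ} (hε : ε ≠ 0) (b : ℝ) (ξ : SmoothVec E U) :
    IsOrbitExtension (smoothFlow U h) b (gaussOp h ε 0 ξ) (fun z => gaussOp h ε (z / ε) ξ) where
  continuousOn := by
    refine Continuous.continuousOn (continuous_iff_continuousAt.2 fun z => ?_)
    exact tendsto_smoothVec_iff.2 fun L =>
      (differentiable_map_gaussOp h hU (wordCLM U L) ε ξ).continuous.tendsto z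
  weaklyHolomorphic α := (differentiable_map_gaussOp h hU α ε ξ).differentiableOn
  extends_orbit t := by
    have := gaussOp_add_ofReal h hU hε t 0 ξ
    rw [add_zero, zero_div] at this
    rw [this, smoothFlow_gaussOp h hU]

lemma tendsto_gaussOp_zero {ε : ℕ → ℝ} (hε : ∀ n, |ε n| ≤ 1) (hε0 : Tendsto ε atTop (𝓝 0))
    (ξ : SmoothVec E U) : Tendsto (fun n => gaussOp h (ε n) 0 ξ) atTop (𝓝 ξ) := by
  refine tendsto_smoothVec_iff.2 fun L => ?_
  obtain ⟨n, C, K, hC, hK, hβ⟩ := exists_norm_map_smoothFlow_le (U := U) h (wordCLM U L)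
  have := tendsto_integral_gaussKer_smul (g := fun s => wordCLM U L (smoothFlow U h s ξ))
    ((wordCLM U L).continuous.comp (continuous_smoothFlow h hU ξ)) hK (fun s => hβ s ξ) hε hε0
  rw [smoothFlow_zero] at this
  exact this.congr fun n => (map_gaussOp h hU (wordCLM U L) (ε n) 0 ξ).symm

end GaussOp

/-! ### Distribution vectors and their weak-* dual -/

section Distribution

variable {E : Type*} [NormedAddCommGroup E] [NormedSpace ℝ E]
  {G : Type*} [TopologicalSpace G] [ChartedSpace E G] [Group G]
  {H : Type*} [NormedAddCommGroup H] [InnerProductSpace ℂ H]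
  {U : G →* (H ≃ₗᵢ[ℂ] H)}

/-- Evaluation of distribution vectors at a smooth vector. -/
def evalDist (ξ : SmoothVec E U) : DistVec E U →L[ℂ] ℂ :=
  PointwiseConvergenceCLM.evalCLM (starRingEnd ℂ) ℂ ξ

lemma evalDist_apply (ξ : SmoothVec E U) (η : DistVec E U) : evalDist ξ η = η ξ := rfl

lemma distVec_ext {η η' : DistVec E U} (h : ∀ ξ, η ξ = η' ξ) : η = η' := ContinuousLinearMap.ext h

lemma distVec_eq_of_dual {η η' : DistVec E U}
    (hsep : ∀ α : DistVec E U →L[ℂ] ℂ, α η = α η') : η = η' :=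
  distVec_ext fun ξ => hsep (evalDist ξ)

/-- Continuous functionals for the weak-* topology are combinations of evaluations. -/
lemma mem_span_evalDist (α : DistVec E U →L[ℂ] ℂ) : (α : DistVec E U →ₗ[ℂ] ℂ) ∈
    Submodule.span ℂ (Set.range fun ξ : SmoothVec E U => (evalDist ξ : DistVec E U →ₗ[ℂ] ℂ)) := by
  rw [LinearMap.mem_span_iff_continuous]
  have h1 := (PointwiseConvergenceCLM.isEmbedding_coeFn (starRingEnd ℂ) (SmoothVec E U) ℂ).eq_induced
  have h2 : (⨅ ξ : SmoothVec E U, TopologicalSpace.induced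
      (evalDist ξ : DistVec E U →ₗ[ℂ] ℂ) inferInstance) =
      (inferInstance : TopologicalSpace (DistVec E U)) := by
    refine Eq.trans ?_ h1.symm
    rw [Pi.topologicalSpace, induced_iInf]
    simp only [induced_compose]
    rfl
  rw [h2]
  exact α.continuous

lemma differentiableOn_dual_of_eval {F : ℂ → DistVec E U} {s : Set ℂ}
    (hF : ∀ ξ, DifferentiableOn ℂ (fun z => F z ξ) s) (α : DistVec E U →L[ℂ] ℂ) :
    DifferentiableOn ℂ (fun z => α (F z)) s := by
  refine Submodule.span_induction (p := fun (β : DistVec E U →ₗ[ℂ] ℂ) _ =>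
    DifferentiableOn ℂ (fun z => β (F z)) s) ?_ ?_ ?_ ?_ (mem_span_evalDist α)
  · rintro _ ⟨ξ, rfl⟩
    exact hF ξ
  · exact differentiableOn_const 0
  · intro β β' _ _ h h'
    exact h.add h'
  · intro c β _ h
    exact h.const_smul c

lemma continuousOn_distVec {F : ℂ → DistVec E U} {s : Set ℂ}
    (hF : ∀ ξ, ContinuousOn (fun z => F z ξ) s) : ContinuousOn F s := fun z hz =>
  PointwiseConvergenceCLM.tendsto_iff_forall_tendsto.2 fun ξ => hF ξ z hz

/-- The complex conjugate of a distribution vector, a continuous linear functional. -/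
def conjDist (η : DistVec E U) : SmoothVec E U →L[ℂ] ℂ where
  toFun ξ := starRingEnd ℂ (η ξ)
  map_add' ξ ζ := by rw [map_add, map_add]
  map_smul' c ξ := by rw [map_smulₛₗ]; simp
  cont := Complex.continuous_conj.comp (ContinuousLinearMap.continuous η)

lemma conjDist_apply (η : DistVec E U) (ξ : SmoothVec E U) :
    conjDist η ξ = starRingEnd ℂ (η ξ) := rfl

end Distribution

/-! ### The KMS space and the annihilator -/

section KMS

variable {E : Type*} [NormedAddCommGroup E] [NormedSpace ℝ E] [FiniteDimensional ℝ E]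
  {G : Type*} [TopologicalSpace G] [T2Space G] [ChartedSpace E G] [Group G]
  [LieGroup 𝓘(ℝ, E) ∞ G]
  {H : Type*} [NormedAddCommGroup H] [InnerProductSpace ℂ H]
  {U : G →* (H ≃ₗᵢ[ℂ] H)} (h : GroupLieAlgebra 𝓘(ℝ, E) G)

/-- The operators `U^∞_{h,ib}` and `U^{-∞}_{h,ib}` are dual to each other. -/
lemma IsOrbitExtension.pairing {b : ℝ} (hb : 0 < b) {η : DistVec E U} {F : ℂ → DistVec E U}
    (hF : IsOrbitExtension (distFlow U h) b η F) {ξ : SmoothVec E U} {f : ℂ → SmoothVec E U}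
    (hf : IsOrbitExtension (smoothFlow U h) b ξ f) :
    F (Complex.I * b) ξ = η (f (Complex.I * b)) := by
  have h1 : ContinuousOn (fun z => conjDist η (f z)) (closedStrip b) :=
    (conjDist η).continuous.comp_continuousOn hf.continuousOn
  have key := eqOn_closedStrip hb ((evalDist ξ).continuous.comp_continuousOn hF.continuousOn)
    (hF.weaklyHolomorphic (evalDist ξ)) (continuousOn_conj_neg_conj h1)
    (differentiableOn_conj_neg_conj (hf.weaklyHolomorphic (conjDist η))) (fun t => ?_)
    (I_mul_mem_closedStrip hb.le)
  · have e : -(starRingEnd ℂ (Complex.I * b)) = Complex.I * b := by simp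
    rw [e] at key
    simpa [conjDist_apply, evalDist_apply] using! key
  · have e : -(starRingEnd ℂ (t : ℂ)) = ((-t : ℝ) : ℂ) := by simp
    simp only [Function.comp_apply, e, hf.extends_orbit, hF.extends_orbit, evalDist_apply,
      conjDist_apply, Complex.conj_conj, distFlow_apply]

variable (J : H →ₗᵢ⋆[ℂ] H) (hJ : ∀ ξ ∈ smoothVectors E U, J ξ ∈ smoothVectors E U)

/-- The annihilator of `(U^∞_{h,iπ} - J^∞) D(U^∞_{h,iπ})`. -/
def kmsAnnihilator : Set (DistVec E U) :=
  realAnnihilator ((fun ξ => extOp (smoothFlow U h) Real.pi ξ - smoothConj J hJ ξ) ''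
    extDomain (smoothFlow U h) Real.pi)

/-- With w = η(Jξ), the pairing and the KMS condition give η(U_{iπ} ξ) = w̄, and w̄ - w has real
part 0. -/
lemma kmsSpace_subset_kmsAnnihilator : kmsSpace U h J hJ ⊆ kmsAnnihilator h J hJ := by
  rintro η ⟨⟨F, hF⟩, hη⟩ _ ⟨ξ, ⟨f, hf⟩, rfl⟩
  rw [hF.extOp_eq Real.pi_pos fun _ _ => distVec_eq_of_dual] at hη
  have h1 := hF.pairing h Real.pi_pos hf
  rw [hη, distConj] at h1
  simp only [hf.extOp_eq Real.pi_pos fun _ _ => smoothVec_eq_of_dual]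
  rw [map_sub, ← h1]
  simp

omit [FiniteDimensional ℝ E] [T2Space G] in
-- The domain is stable under multiplication by i, U_{iπ} is linear, and J and η are antilinear.
-- Testing with ξ equates the real parts of η(U_{iπ} ξ) and η(Jξ); testing with iξ makes their
-- imaginary parts opposite.
lemma eq_conj_of_mem_kmsAnnihilator {η : DistVec E U} (hη : η ∈ kmsAnnihilator h J hJ)
    {ξ : SmoothVec E U} {f : ℂ → SmoothVec E U}
    (hf : IsOrbitExtension (smoothFlow U h) Real.pi ξ f) :
    η (f (Complex.I * Real.pi)) = starRingEnd ℂ (η (smoothConj J hJ ξ)) := by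
  have h1 := hη _ ⟨ξ, ⟨f, hf⟩, rfl⟩
  have hf' := hf.smul Complex.I fun t => smoothFlow_smul h t _ _
  have h2 := hη _ ⟨Complex.I • ξ, ⟨_, hf'⟩, rfl⟩
  simp only [hf.extOp_eq Real.pi_pos fun _ _ => smoothVec_eq_of_dual] at h1
  simp only [hf'.extOp_eq Real.pi_pos fun _ _ => smoothVec_eq_of_dual] at h2
  have e : smoothConj J hJ (Complex.I • ξ) = (-Complex.I) • smoothConj J hJ ξ :=
    SmoothVec.ext ((J.map_smulₛₗ Complex.I ξ.val).trans (by rw [Complex.conj_I]; rfl))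
  rw [e, map_sub, map_smulₛₗ, map_smulₛₗ] at h2
  rw [map_sub] at h1
  simp only [map_neg, Complex.conj_I, smul_eq_mul, Complex.sub_re, Complex.mul_re, Complex.neg_re,
    Complex.I_re, Complex.neg_im, Complex.I_im] at h1 h2
  apply Complex.ext
  · rw [Complex.conj_re]; linarith
  · rw [Complex.conj_im]; linarith

variable [CompleteSpace H] (hU : ∀ ξ : H, Continuous fun g => U g ξ)
  (hJ_comm : ∀ (t : ℝ) (ξ : H), J (U (lieExp (t • h)) ξ) = U (lieExp (t • h)) (J ξ))
include hU hJ_comm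

omit [FiniteDimensional ℝ E] [T2Space G] [CompleteSpace H] hU in
lemma smoothConj_smoothFlow (t : ℝ) (ξ : SmoothVec E U) :
    smoothConj J hJ (smoothFlow U h t ξ) = smoothFlow U h t (smoothConj J hJ ξ) :=
  SmoothVec.ext (hJ_comm t ξ.val)

/-- At w = 0 the kernel is real, so the antilinear J passes under the integral. Only continuity of J
on H is used, not on H^∞. -/
lemma smoothConj_gaussOp (ε : ℝ) (ξ : SmoothVec E U) :
    smoothConj J hJ (gaussOp h ε 0 ξ) = gaussOp h ε 0 (smoothConj J hJ ξ) := by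
  have hi := integrable_comp_of_sobolev (continuous_gaussIntegrand h hU ε 0 ξ)
    (integrable_sobolev_gaussIntegrand h hU ε 0 ξ) (wordCLM U [])
  let Jr : H →L[ℝ] H :=
    { toFun := J
      map_add' := J.map_add
      map_smul' := fun r x => by
        have := J.map_smulₛₗ (r : ℂ) x
        simpa using this
      cont := J.continuous }
  apply SmoothVec.ext
  rw [val_gaussOp h hU]
  have h1 : (smoothConj J hJ (gaussOp h ε 0 ξ)).val = Jr (gaussOp h ε 0 ξ).val := rfl
  rw [h1, val_gaussOp h hU]
  refine (Jr.integral_comp_comm hi).symm.trans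
    (integral_congr_ae (Eventually.of_forall fun s => ?_))
  simp only [← smoothConj_smoothFlow h J hJ hJ_comm]
  refine (J.map_smulₛₗ (gaussKer (s - 0)) (smoothFlow U h (ε * s) ξ).val).trans ?_
  have h2 := conj_gaussKer_ofReal s
  rw [sub_zero, h2]
  rfl

/-- For `η` in the annihilator, the regularized matrix coefficients converge on the strip. -/
lemma exists_strip_limit_of_mem_kmsAnnihilator {η : DistVec E U}
    (hη : η ∈ kmsAnnihilator h J hJ) {ε : ℕ → ℝ} (hε0 : ∀ n, ε n ≠ 0) (hε1 : ∀ n, |ε n| ≤ 1)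
    (hε : Tendsto ε atTop (𝓝 0)) (ξ : SmoothVec E U) :
    ∃ Ψ : ℂ → ℂ, ContinuousOn Ψ (closedStrip Real.pi) ∧
      DifferentiableOn ℂ Ψ (openStrip Real.pi) ∧ ∀ z ∈ closedStrip Real.pi,
        Tendsto (fun n => conjDist η (gaussOp h (ε n) (z / ε n) ξ)) atTop (𝓝 (Ψ z)) := by
  obtain ⟨k, C, K, hC, hK, hβ⟩ := exists_norm_map_smoothFlow_le (U := U) h (conjDist η)
  obtain ⟨k', C', K', hC', hK', hβ'⟩ := exists_norm_map_gaussOp_le h hU (conjDist η)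
  set ξ' := smoothConj J hJ ξ with hξ'
  set L := max K K'
  have hreal : ∀ n (t : ℝ), conjDist η (gaussOp h (ε n) ((t : ℂ) / ε n) ξ) =
      conjDist η (smoothFlow U h t (gaussOp h (ε n) 0 ξ)) := by
    intro n t
    have := gaussOp_add_ofReal h hU (hε0 n) t 0 ξ
    rw [add_zero, zero_div] at this
    rw [this, smoothFlow_gaussOp h hU]
  -- On the upper boundary the annihilator identity trades the extension to iπ for J, leaving
  -- real-time orbits of regularizations of Jξ.
  have htop : ∀ n (t : ℝ),
      conjDist η (gaussOp h (ε n) (((t : ℂ) + Complex.I * Real.pi) / ε n) ξ) =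
      starRingEnd ℂ (conjDist η (smoothFlow U h t (gaussOp h (ε n) 0 ξ'))) := by
    intro n t
    rw [gaussOp_add_ofReal h hU (hε0 n), conjDist_apply, eq_conj_of_mem_kmsAnnihilator h J hJ hη
      (isOrbitExtension_gaussOp h hU (hε0 n) Real.pi (smoothFlow U h t ξ)),
      smoothConj_gaussOp h J hJ hU hJ_comm, smoothConj_smoothFlow h J hJ hJ_comm,
      ← smoothFlow_gaussOp h hU]
    rfl
  have hdiff : ∀ (ζ : SmoothVec E U) (n m : ℕ) (t : ℝ),
      ‖conjDist η (smoothFlow U h t (gaussOp h (ε n) 0 ζ)) -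
        conjDist η (smoothFlow U h t (gaussOp h (ε m) 0 ζ))‖ ≤
      (C * sobolev U k (gaussOp h (ε n) 0 ζ - ζ) + C * sobolev U k (gaussOp h (ε m) 0 ζ - ζ)) *
        Real.exp (L * |t|) := by
    intro ζ n m t
    have e : conjDist η (smoothFlow U h t (gaussOp h (ε n) 0 ζ)) -
        conjDist η (smoothFlow U h t (gaussOp h (ε m) 0 ζ)) =
        conjDist η (smoothFlow U h t (gaussOp h (ε n) 0 ζ - ζ)) -
        conjDist η (smoothFlow U h t (gaussOp h (ε m) 0 ζ - ζ)) := by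
      rw [← map_sub, ← map_sub]
      congr 1
      change smoothAct U _ _ - smoothAct U _ _ = smoothAct U _ _ - smoothAct U _ _
      rw [← map_sub, ← map_sub]
      congr 1
      abel
    rw [e, add_mul]
    have hexp : Real.exp (K * |t|) ≤ Real.exp (L * |t|) := by
      gcongr
      exact le_max_left _ _
    refine (norm_sub_le _ _).trans (add_le_add ((hβ t _).trans ?_) ((hβ t _).trans ?_)) <;>
    exact mul_le_mul_of_nonneg_left hexp (mul_nonneg hC (apply_nonneg _ _))
  have hconv : ∀ ζ : SmoothVec E U,
      Tendsto (fun n => C * sobolev U k (gaussOp h (ε n) 0 ζ - ζ)) atTop (𝓝 0) := by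
    intro ζ
    have h1 : Tendsto (fun n => gaussOp h (ε n) 0 ζ - ζ) atTop (𝓝 (ζ - ζ)) :=
      (tendsto_gaussOp_zero h hU hε1 hε ζ).sub tendsto_const_nhds
    have h2 := (((continuous_sobolev k).tendsto _).comp h1).const_mul C
    simpa using! h2
  refine exists_strip_limit
    (e := fun n => C * sobolev U k (gaussOp h (ε n) 0 ξ - ξ) +
      C * sobolev U k (gaussOp h (ε n) 0 ξ' - ξ')) (K := L)
    (fun n => differentiable_map_gaussOp h hU (conjDist η) (ε n) ξ) (fun n => ?_)
    (by simpa using (hconv ξ).add (hconv ξ')) (fun n m t => ?_) (fun n m t => ?_)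
  -- The constant may blow up with n, but the exponent does not: K'|ε|·|Re(z)/ε| = K'|Re z|.
  · refine ⟨gaussBound (K' * |ε n|) (Real.pi / |ε n|) * (C' * sobolev U k' ξ), fun z hz => ?_⟩
    have hpos : 0 < |ε n| := abs_pos.2 (hε0 n)
    refine (hβ' (ε n) (z / ε n) ξ).trans ?_
    rw [Complex.div_ofReal_im, Complex.div_ofReal_re, abs_div, mul_assoc K', mul_div_cancel₀ _ hpos.ne']
    have h1 : |z.im / ε n| ≤ Real.pi / |ε n| := by
      rw [abs_div, abs_of_nonneg hz.1]
      gcongr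
      exact hz.2
    have h2 : 0 ≤ C' * sobolev U k' ξ := mul_nonneg hC' (apply_nonneg _ _)
    gcongr
    · exact mul_nonneg (gaussBound_nonneg _ _) h2
    · exact gaussBound_le h1
    · exact le_max_right _ _
  · rw [hreal, hreal]
    refine (hdiff ξ n m t).trans (mul_le_mul_of_nonneg_right ?_ (Real.exp_pos _).le)
    have h1 : 0 ≤ C * sobolev U k (gaussOp h (ε n) 0 ξ' - ξ') := mul_nonneg hC (apply_nonneg _ _)
    have h2 : 0 ≤ C * sobolev U k (gaussOp h (ε m) 0 ξ' - ξ') := mul_nonneg hC (apply_nonneg _ _)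
    linarith
  · rw [htop, htop, ← map_sub, RCLike.norm_conj]
    refine (hdiff ξ' n m t).trans (mul_le_mul_of_nonneg_right ?_ (Real.exp_pos _).le)
    have h1 : 0 ≤ C * sobolev U k (gaussOp h (ε n) 0 ξ - ξ) := mul_nonneg hC (apply_nonneg _ _)
    have h2 : 0 ≤ C * sobolev U k (gaussOp h (ε m) 0 ξ - ξ) := mul_nonneg hC (apply_nonneg _ _)
    linarith

lemma kmsAnnihilator_subset_kmsSpace : kmsAnnihilator h J hJ ⊆ kmsSpace U h J hJ := by
  intro η hη
  set ε : ℕ → ℝ := fun n => 1 / ((n : ℝ) + 1)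
  have hεpos : ∀ n, 0 < ε n := fun n => by positivity
  have hε1 : ∀ n, |ε n| ≤ 1 := fun n => by
    rw [abs_of_pos (hεpos n), div_le_one (by positivity)]
    linarith [(Nat.cast_nonneg n : (0 : ℝ) ≤ n)]
  have hε : Tendsto ε atTop (𝓝 0) := tendsto_one_div_add_atTop_nhds_zero_nat
  choose Ψ hΨc hΨd hΨ using fun ξ => exists_strip_limit_of_mem_kmsAnnihilator h J hJ hU hJ_comm hη
    (fun n => (hεpos n).ne') hε1 hε ξ
  have hex : ∀ z ∈ closedStrip Real.pi, ∃ η' : DistVec E U, ∀ ξ,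
      η' ξ = starRingEnd ℂ (Ψ ξ (-(starRingEnd ℂ z))) := by
    intro z hz
    -- The approximants ξ ↦ η(U_{-z̄} ξ_n) are distribution vectors because the regularization is
    -- continuous on H^∞; Banach–Steinhaus applies to their pointwise limit.
    refine exists_distVec_of_tendsto
      (fun n => ContinuousLinearMap.comp (σ₁₂ := RingHom.id ℂ) (σ₂₃ := starRingEnd ℂ)
        (σ₁₃ := starRingEnd ℂ) η (gaussCLM h hU (ε n) (-(starRingEnd ℂ z) / ε n))) _ fun ξ => ?_
    have h1 := (Complex.continuous_conj.tendsto _).comp (hΨ ξ _ (neg_conj_mem_closedStrip hz))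
    refine h1.congr fun n => ?_
    simp only [Function.comp_apply, conjDist_apply, Complex.conj_conj]
    rfl
  choose! F hF using hex
  have hext : IsOrbitExtension (distFlow U h) Real.pi η F :=
    { continuousOn := continuousOn_distVec fun ξ =>
        (continuousOn_conj_neg_conj (hΨc ξ)).congr fun z hz => hF z hz ξ
      weaklyHolomorphic := differentiableOn_dual_of_eval fun ξ =>
        (differentiableOn_conj_neg_conj (hΨd ξ)).congr fun z hz =>
          hF z (openStrip_subset_closedStrip _ hz) ξ
      extends_orbit := fun t => by
        have hz := ofReal_mem_closedStrip Real.pi_pos.le t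
        refine distVec_ext fun ξ => ?_
        rw [hF _ hz, distFlow_apply]
        have e : -(starRingEnd ℂ (t : ℂ)) = ((-t : ℝ) : ℂ) := by simp
        have h1 : Ψ ξ ((-t : ℝ) : ℂ) = conjDist η (smoothFlow U h (-t) ξ) := by
          refine tendsto_nhds_unique (hΨ ξ _ (ofReal_mem_closedStrip Real.pi_pos.le _)) ?_
          have h2 := ((conjDist η).continuous.tendsto _).comp
            (tendsto_gaussOp_zero h hU hε1 hε (smoothFlow U h (-t) ξ))
          refine h2.congr fun n => ?_
          have h3 := gaussOp_add_ofReal h hU (hεpos n).ne' (-t) 0 ξ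
          rw [add_zero, zero_div] at h3
          rw [h3]; rfl
        rw [e, h1, conjDist_apply, Complex.conj_conj] }
  refine ⟨⟨F, hext⟩, ?_⟩
  rw [hext.extOp_eq Real.pi_pos fun _ _ => distVec_eq_of_dual]
  funext ξ
  have hz := I_mul_mem_closedStrip Real.pi_pos.le
  rw [hF _ hz, distConj]
  have e : -(starRingEnd ℂ (Complex.I * Real.pi)) = Complex.I * Real.pi := by simp
  rw [e]
  congr 1
  -- By the annihilator identity the approximants at iπ equal η((Jξ)_n), which tend to η(Jξ) by
  -- continuity of η.
  refine tendsto_nhds_unique (hΨ ξ _ hz) ?_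
  have h2 := ((ContinuousLinearMap.continuous η).tendsto _).comp
    (tendsto_gaussOp_zero h hU hε1 hε (smoothConj J hJ ξ))
  refine h2.congr fun n => ?_
  rw [conjDist_apply, eq_conj_of_mem_kmsAnnihilator h J hJ hη
    (isOrbitExtension_gaussOp h hU (hεpos n).ne' Real.pi ξ), smoothConj_gaussOp h J hJ hU hJ_comm,
    Complex.conj_conj]
  rfl

end KMS

/-! ### Real annihilators are weak-* closed real subspaces -/

section RealAnnihilator

variable {E : Type*} [NormedAddCommGroup E] [NormedSpace ℝ E]
  {G : Type*} [TopologicalSpace G] [ChartedSpace E G] [Group G]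
  {H : Type*} [NormedAddCommGroup H] [InnerProductSpace ℂ H]
  {U : G →* (H ≃ₗᵢ[ℂ] H)} (S : Set (SmoothVec E U))

lemma isClosed_realAnnihilator : IsClosed (realAnnihilator S) := by
  have : realAnnihilator S = ⋂ ξ ∈ S, {η : DistVec E U | (evalDist ξ η).re = 0} := by
    ext η
    simp only [Set.mem_iInter]
    rfl
  rw [this]
  exact isClosed_biInter fun ξ _ =>
    isClosed_eq (Complex.continuous_re.comp (evalDist ξ).continuous) continuous_const

/-- The annihilator with respect to the real duality pairing as a real subspace. -/
def realAnnihilatorSubmodule : Submodule ℝ (DistVec E U) where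
  carrier := realAnnihilator S
  zero_mem' _ _ := rfl
  add_mem' {η η'} hη hη' ξ hξ := by
    change (evalDist ξ (η + η')).re = 0
    rw [map_add, Complex.add_re, evalDist_apply, evalDist_apply, hη ξ hξ, hη' ξ hξ, add_zero]
  smul_mem' c η hη ξ hξ := by
    change (c • η ξ).re = 0
    rw [Complex.real_smul, Complex.re_ofReal_mul, hη ξ hξ, mul_zero]

end RealAnnihilator

end LieRep

end

theorem mainTheorem3
    {E : Type*} [NormedAddCommGroup E] [NormedSpace ℝ E] [FiniteDimensional ℝ E]
    {G : Type*} [TopologicalSpace G] [T2Space G] [ChartedSpace E G] [Group G]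
    [LieGroup 𝓘(ℝ, E) ∞ G]
    {H : Type*} [NormedAddCommGroup H] [InnerProductSpace ℂ H] [CompleteSpace H]
    (U : G →* (H ≃ₗᵢ[ℂ] H)) (hU : ∀ ξ : H, Continuous fun g => U g ξ)
    (h : GroupLieAlgebra 𝓘(ℝ, E) G)
    (J : H →ₗᵢ⋆[ℂ] H) (hJ_inv : ∀ ξ, J (J ξ) = ξ)
    (hJ_comm : ∀ (t : ℝ) (ξ : H), J (U (LieRep.lieExp (t • h)) ξ) =
      U (LieRep.lieExp (t • h)) (J ξ))
    (hJ_smooth : ∀ ξ ∈ LieRep.smoothVectors E U, J ξ ∈ LieRep.smoothVectors E U) :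
    (∃ S : Submodule ℝ (LieRep.DistVec E U),
      (S : Set (LieRep.DistVec E U)) = LieRep.kmsSpace U h J hJ_smooth) ∧
    IsClosed (LieRep.kmsSpace U h J hJ_smooth) ∧
    LieRep.kmsSpace U h J hJ_smooth =
      LieRep.realAnnihilator
        ((fun ξ => LieRep.extOp (LieRep.smoothFlow U h) Real.pi ξ -
            LieRep.smoothConj J hJ_smooth ξ) ''
          LieRep.extDomain (LieRep.smoothFlow U h) Real.pi) := by
  have key : LieRep.kmsSpace U h J hJ_smooth = LieRep.kmsAnnihilator h J hJ_smooth :=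
    (LieRep.kmsSpace_subset_kmsAnnihilator h J hJ_smooth).antisymm
      (LieRep.kmsAnnihilator_subset_kmsSpace h J hJ_smooth hU hJ_comm)
  exact ⟨⟨LieRep.realAnnihilatorSubmodule _, key.symm⟩,
    key ▸ LieRep.isClosed_realAnnihilator _, key⟩
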